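/- **Setting.** Let $r$ be the number of antennas of node B (node A has one), let $L_c$ be the coherence time and $L_{A,\tau_1},L_{B,\tau},L_{A,\tau_2}\ge 1$ the training durations in symbols, and put $$\alpha=\frac{L_c-L_{B,\tau}-L_{A,\tau_1}-L_{A,\tau_2}}{L_c}.$$ The channel $\mathbf h\in\mathbb C^r$, the noises $\mathbf w_1,\mathbf w_2,\mathbf w_3\in\mathbb C^r$ and $w_A\in\mathbb C$, and the data symbol $x\in\mathbb C$ are independent with i.i.d. $\mathcal{CN}(0,1)$ entries. Let $\bar P$ be the average power, $R_{\bar P}>0$ (for all large $\bar P$) the target rate in nats, with multiplexing gain $g_m=\lim_{\bar P\to\infty}R_{\bar P}/\log\bar P$, and let $c>0$, $\kappa_{\bar P}>0$. The protocol is as follows. * Phase I: node B receives $\mathbf y_1=\sqrt{\bar PL_{A,\tau_1}}\,\mathbf h+\mathbf w_1$ and forms $\hat{\mathbf h}=\mathbb E[\mathbf h\mid\mathbf y_1]$, $\hat{\mathbf v}=\hat{\mathbf h}/\|\hat{\mathbf h}\|$. * Phase II: node A receives $y_A=\sqrt{\bar PL_{B,\tau}}\,\mathbf h^H\hat{\mathbf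 v}+w_A$ and forms $\hat\sigma=\Re\{y_A\}/\sqrt{\bar PL_{B,\tau}}$. It uses the normalized power $$\mathcal P(\hat\sigma)=\begin{cases}c\,\bar P^{\,l}, & \hat\sigma\le \bar P^{-1/2},\\[2pt] \kappa_{\bar P}\,\dfrac{\exp(R_{\bar P}/\alpha)-1}{\hat\sigma^{2s}}, & \hat\sigma>\bar P^{-1/2}.\end{cases}$$ * Phase III: with $\mathbf p_c=\sqrt{\mathcal P(\hat\sigma)}\,\mathbf h$, node B receives $\sqrt{\bar PL_{A,\tau_2}}\,\mathbf p_c+\mathbf w_2$. It divides this by $\sqrt{\bar PL_{A,\tau_2}}$ to get $\tilde{\mathbf y}$, and forms $\hat{\mathbf p}_c=\mathbb E[\mathbf p_c\mid\tilde{\mathbf y}]$ and $\tilde{\mathbf p}_c=\mathbf p_c-\hat{\mathbf p}_c$. * Phase IV: node B receives the data $\mathbf y_d=\sqrt{\bar P\,\mathcal P(\hat\sigma)}\,\mathbf h\,x+\mathbf w_3$. Let $I(x;\mathbf y_d\mid\hat{\mathbf p}_c)$ be the mutual information given the realized value of $\hat{\mathbf p}_c$, and let $$C_{AB}=\alpha\log\left(1+\frac{\bar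 P\|\hat{\mathbf p}_c\|^2}{\frac{\bar P}{r}\,\mathbb E[\|\tilde{\mathbf p}_c\|^2\mid\tilde{\mathbf y}]+1}\right)$$ be the rate of the worst-case-noise bound. **Theorem 2.** Let $0\le l\le r$, $1\le s<r$ and $0\le g_m<\alpha$. Then there are $c>0$, with $c=1$ if $l<r$, and $\kappa_{\bar P}$ such that, for all large $\bar P$, $\kappa_{\bar P}>0$ and $\mathbb E[\mathcal P(\hat\sigma)]=1$ (average transmit power $\bar P$), and such that the protocol achieves the diversity order $$d(g_m)=r\left(\min\{l,s\}+1-\frac{g_m}{\alpha}\right).$$ That is, $\liminf_{\bar P\to\infty}\left(-\log P_{out}/\log\bar P\right)\ge d(g_m)$, both for $P_{out}=\Pr\{C_{AB}<R_{\bar P}\}$ and for $P_{out}=\Pr\{\alpha\, I(x;\mathbf y_d\mid\hat{\mathbf p}_c)<R_{\bar P}\}$. -/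

import Mathlib

open MeasureTheory ProbabilityTheory Filter Topology
open scoped ENNReal

namespace ThreeWay

noncomputable section

/-- `ℂ^r` with the Euclidean norm. -/
abbrev CVec (r : ℕ) : Type := EuclideanSpace ℂ (Fin r)

/-- The circularly symmetric complex Gaussian law `CN(0, 1)`: the real and the imaginary part are
independent real Gaussians with mean `0` and variance `1 / 2`. -/
def cn : Measure ℂ :=
  ((gaussianReal 0 (1 / 2)).prod (gaussianReal 0 (1 / 2))).map fun p => (⟨p.1, p.2⟩ : ℂ)

/-- The law of a vector in `ℂ^r` whose entries are i.i.d. `CN(0, 1)`. -/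
def cnVec (r : ℕ) : Measure (CVec r) :=
  (Measure.pi fun _ : Fin r => cn).map (WithLp.toLp 2)

/-- The random quantities of one coherence block. -/
structure Signals (r : ℕ) (Ω : Type*) where
  /-- forward channel -/
  h : Ω → CVec r
  /-- noise at node B in phase I -/
  w₁ : Ω → CVec r
  /-- noise at node A in phase II -/
  wA : Ω → ℂ
  /-- noise at node B in phase III -/
  w₂ : Ω → CVec r
  /-- data symbol sent by node A in phase IV -/
  x : Ω → ℂ
  /-- noise at node B in phase IV -/
  w₃ : Ω → CVec r

/-- Rayleigh fading, additive white Gaussian noise and Gaussian signalling: the channel, the noises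
and the data symbol are independent, with i.i.d. `CN(0, 1)` entries. -/
structure Signals.IsRayleigh {r : ℕ} {Ω : Type*} [MeasurableSpace Ω] (S : Signals r Ω)
    (μ : Measure Ω) : Prop where
  measurable_h : Measurable S.h
  measurable_w₁ : Measurable S.w₁
  measurable_wA : Measurable S.wA
  measurable_w₂ : Measurable S.w₂
  measurable_x : Measurable S.x
  measurable_w₃ : Measurable S.w₃
  law : μ.map (fun ω => (S.h ω, S.w₁ ω, S.wA ω, S.w₂ ω, S.x ω, S.w₃ ω)) =
    (cnVec r).prod ((cnVec r).prod (cn.prod ((cnVec r).prod (cn.prod (cnVec r)))))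

/-- The parameters of the protocol, at all average powers `P`. -/
structure Params where
  /-- coherence time, in symbols -/
  Lc : ℕ
  /-- training duration of phase I (forward) -/
  L₁ : ℕ
  /-- training duration of phase II (reverse) -/
  LB : ℕ
  /-- training duration of phase III (forward) -/
  L₂ : ℕ
  /-- power exponent used when the channel estimate is below the threshold -/
  l : ℝ
  /-- channel inversion exponent used when the channel estimate is above the threshold -/
  s : ℝ
  /-- constant scaling factor of the power used below the threshold -/
  c : ℝ
  /-- power normalization `κ_P` -/
  κ : ℝ → ℝ
  /-- target data rate `R_P`, in nats per symbol -/
  R : ℝ → ℝ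

/-- The fraction `α` of the coherence time that is left for data. -/
def dataFraction (Lc L₁ LB L₂ : ℕ) : ℝ :=
  ((Lc : ℝ) - (LB : ℝ) - (L₁ : ℝ) - (L₂ : ℝ)) / (Lc : ℝ)

/-- The minimum mean square error estimate of `X` from the observation `Y`. -/
def mmse {Ω E F : Type*} [MeasurableSpace Ω] [NormedAddCommGroup E] [NormedSpace ℝ E]
    [CompleteSpace E] [MeasurableSpace F] (μ : Measure Ω) (X : Ω → E) (Y : Ω → F) : Ω → E :=
  condExp (MeasurableSpace.comap Y inferInstance) μ X

/-- The mutual information (in nats) of the two components of a random pair with law `ρ`. -/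
def mutualInfo {A B : Type*} [MeasurableSpace A] [MeasurableSpace B] (ρ : Measure (A × B)) : ℝ≥0∞ :=
  InformationTheory.klDiv ρ (ρ.fst.prod ρ.snd)

/-- The mutual information `I(X; Y | T = t)`. -/
def condMutualInfo {Ω A B C : Type*} [MeasurableSpace Ω]
    [MeasurableSpace A] [StandardBorelSpace A] [Nonempty A]
    [MeasurableSpace B] [StandardBorelSpace B] [Nonempty B] [MeasurableSpace C]
    (μ : Measure Ω) [IsFiniteMeasure μ] (X : Ω → A) (Y : Ω → B) (T : Ω → C) (t : C) : ℝ≥0∞ :=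
  mutualInfo (condDistrib (fun ω => (X ω, Y ω)) T μ t)

/-- The diversity order `- lim log (p P) / log P` of a family of probabilities (as a limit
inferior, with values in the extended reals and `log 0 = -∞`). -/
def diversityOrder (p : ℝ → ℝ≥0∞) : EReal :=
  liminf (fun P : ℝ => -(ENNReal.log (p P)) / ((Real.log P : ℝ) : EReal)) atTop

section Protocol

variable {r : ℕ} {Ω : Type*} [MeasurableSpace Ω] (μ : Measure Ω) (S : Signals r Ω) (Q : Params)
  (P : ℝ)

/-- The fraction `α` of the coherence time that is left for data. -/
def Params.α : ℝ := dataFraction Q.Lc Q.L₁ Q.LB Q.L₂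

/-- Phase I: fixed-power forward training, as received at node B. -/
def y₁ (ω : Ω) : CVec r :=
  ((Real.sqrt (P * Q.L₁) : ℝ) : ℂ) • S.h ω + S.w₁ ω

/-- The estimate `ĥ` of the channel at node B. -/
def hHat : Ω → CVec r := mmse μ S.h (y₁ S Q P)

/-- The estimated channel direction `v̂ = ĥ / ‖ĥ‖` at node B. -/
def vHat (ω : Ω) : CVec r := ((‖hHat μ S Q P ω‖⁻¹ : ℝ) : ℂ) • hHat μ S Q P ω

/-- The channel-dependent reverse training signal of node B. -/
def xB (ω : Ω) : CVec r := ((Real.sqrt (P * Q.LB) : ℝ) : ℂ) • vHat μ S Q P ω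

/-- Phase II: reverse training, as received at node A (`inner ℂ h x = hᴴ x`). -/
def yA (ω : Ω) : ℂ := inner ℂ (S.h ω) (xB μ S Q P ω) + S.wA ω

/-- The estimate `σ̂` of `‖h‖` at node A. -/
def sigmaHat (ω : Ω) : ℝ := (yA μ S Q P ω).re / Real.sqrt (P * Q.LB)

/-- The channel inversion function `Φ`. -/
def Φ (u : ℝ) : ℝ := (Real.exp (Q.R P / Q.α) - 1) / u

/-- The power control function, with threshold `1 / √P`. -/
def power (t : ℝ) : ℝ :=
  if t ≤ 1 / Real.sqrt P then Q.c * P ^ Q.l else Q.κ P * Φ Q P (t ^ (2 * Q.s))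

/-- The power chosen by node A on the basis of its estimate. -/
def txPower (ω : Ω) : ℝ := power Q P (sigmaHat μ S Q P ω)

/-- The composite channel `p_c`. -/
def pc (ω : Ω) : CVec r := ((Real.sqrt (txPower μ S Q P ω) : ℝ) : ℂ) • S.h ω

/-- Phase III: power-controlled forward training, as received at node B. -/
def y₂ (ω : Ω) : CVec r :=
  ((Real.sqrt (P * Q.L₂) * Real.sqrt (txPower μ S Q P ω) : ℝ) : ℂ) • S.h ω + S.w₂ ω

/-- The received training signal of phase III after normalization. -/
def y₂n (ω : Ω) : CVec r := (((Real.sqrt (P * Q.L₂))⁻¹ : ℝ) : ℂ) • y₂ μ S Q P ω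

/-- The estimate of the composite channel at node B. -/
def pcHat : Ω → CVec r := mmse μ (pc μ S Q P) (y₂n μ S Q P)

/-- The error in the estimate of the composite channel. -/
def pcErr (ω : Ω) : CVec r := pc μ S Q P ω - pcHat μ S Q P ω

/-- The conditional mean square error, given the received training signal of phase III. -/
def condErr : Ω → ℝ :=
  condExp (MeasurableSpace.comap (y₂n μ S Q P) inferInstance) μ fun ω => ‖pcErr μ S Q P ω‖ ^ 2

/-- Phase IV: power-controlled data, as received at node B. -/
def yd (ω : Ω) : CVec r :=
  ((Real.sqrt (P * txPower μ S Q P ω) : ℝ) : ℂ) • (S.x ω • S.h ω) + S.w₃ ω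

/-- The worst-case-noise rate `C_AB`, in nats per symbol. -/
def CAB (ω : Ω) : ℝ :=
  Q.α * Real.log (1 + P * ‖pcHat μ S Q P ω‖ ^ 2 / (P / r * condErr μ S Q P ω + 1))

/-- The probability that the target rate exceeds `C_AB`. -/
def outageCAB : ℝ≥0∞ := μ {ω | CAB μ S Q P ω < Q.R P}

/-- The probability that the target rate exceeds `α · I(x; y | p̂_c)`, the rate supported by
Gaussian signalling given the estimate of the composite channel at node B. -/
def outageMI [IsFiniteMeasure μ] : ℝ≥0∞ :=
  μ {ω | ENNReal.ofReal Q.α *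
      condMutualInfo μ S.x (yd μ S Q P) (pcHat μ S Q P) (pcHat μ S Q P ω) <
    ENNReal.ofReal (Q.R P)}

end Protocol

end

end ThreeWay

namespace ThreeWay

/-! ### Gaussian estimates: symmetry, small balls, negative moments. -/

section GaussianFacts

/-! Write $a=g_m/\alpha<1$. Both outage events reduce, up to probabilities that decay faster than
every power of $P$, to one event: the estimated composite channel is weak, $\|\hat{\mathbf
p}_c\|<P^{(a-1)/2+O(\varepsilon)}$. The error $\tilde{\mathbf p}_c$ is of size $P^{-1/2}$ with all
moments under control, because $\tilde{\mathbf y}$ is $\mathbf p_c$ plus scaled Gaussian noise and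
conditional expectation contracts every $L^p$ norm (`eLpNorm_pcErr_le`). So $\sqrt{\mathcal
P(\hat\sigma)}\,\|\mathbf h\|$ must itself be small. Since $\hat\sigma\le\|\mathbf h\|+\|w_A\|/\sqrt
P$, a deterministic case analysis (`norm_le_of_composite_small`) then forces $\|\mathbf h\|^2\le
P^{-(\min\{l,s\}+1-a)+O(\varepsilon)}$, an event whose probability is at most $(4\|\cdot\|^2)^r$
evaluated at that radius. This gives the diversity order as $\varepsilon\to0$.

The case analysis needs $\kappa_P(e^{R_P/\alpha}-1)$ bounded below while the mean power equals one
(`exists_normalization`). For this $\hat\sigma$ must not be small too often. Rotating $(\mathbf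
h,\mathbf w_1)$ into the normalized observation $Y$ and an independent residual $Z$ gives
$\hat\sigma\ge\|Y\|/2-(\|Z\|+\|w_A\|)/\sqrt P$ (`exists_sigmaHat_ge`). Hence $\Pr\{\hat\sigma\le
P^{-1/2}\}=O(P^{-r})$, which makes the power $cP^l$ affordable for $l\le r$, and $\hat\sigma^{-2s}$
above the threshold has bounded mean, because $E\|Y\|^{-2s}<\infty$ for $s<r$.

For $C_{AB}$, a strong $\hat{\mathbf p}_c$ and a small conditional error give the rate directly
(`outageCAB_le`). For the mutual information, the worst-case-noise bound is not used: a linear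
estimate recovers $x$ to accuracy $P^{-a/2-\varepsilon}$ with high conditional probability, and the
Donsker–Varadhan inequality turns this into at least $R_P/\alpha$ nats
(`le_mutualInfo_of_estimator`, `outageMI_le`). -/

theorem cn_eq_map : cn = ((gaussianReal 0 (1 / 2)).prod (gaussianReal 0 (1 / 2))).map
    Complex.equivRealProdCLM.symm := by
  unfold cn
  congr 1

instance isGaussian_cn : IsGaussian cn := by
  rw [cn_eq_map]; infer_instance

theorem isGaussian_pi_cn (r : ℕ) : IsGaussian (Measure.pi fun _ : Fin r => cn) := by
  have h := (iIndepFun.hasGaussianLaw (P := Measure.pi fun _ : Fin r => cn)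
    (X := fun i (x : Fin r → ℂ) => x i) (fun i => ?_)
    (iIndepFun_pi (X := fun _ => id) fun _ => aemeasurable_id)).isGaussian_map
  · simpa using h
  · refine ⟨?_⟩
    rw [(measurePreserving_eval (fun _ : Fin r => cn) i).map_eq]
    infer_instance

theorem cnVec_eq_map (r : ℕ) : cnVec r = (Measure.pi fun _ : Fin r => cn).map
    ((PiLp.continuousLinearEquiv 2 ℝ fun _ : Fin r => ℂ).symm) := rfl

instance isGaussian_cnVec (r : ℕ) : IsGaussian (cnVec r) := by
  have := isGaussian_pi_cn r
  rw [cnVec_eq_map]; infer_instance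

theorem integral_id_eq_zero_of_map_neg {E : Type*} [NormedAddCommGroup E] [NormedSpace ℝ E]
    [MeasurableSpace E] [BorelSpace E] [SecondCountableTopology E] {ν : Measure E}
    (h : ν.map (fun z => -z) = ν) : ∫ z, z ∂ν = 0 := by
  have : ∫ z, z ∂ν = -∫ z, z ∂ν := by
    conv_lhs => rw [← h]
    rw [integral_map (by fun_prop) (by fun_prop), integral_neg]
  have h2 : (2 : ℝ) • ∫ z, z ∂ν = 0 := by rw [two_smul]; nth_rw 1 [this]; simp
  exact (smul_eq_zero.1 h2).resolve_left two_ne_zero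

theorem map_neg_cn : cn.map (fun z => -z) = cn := by
  have h0 : (gaussianReal 0 (1 / 2)).map (fun x => -x) = gaussianReal 0 (1 / 2) := by
    rw [gaussianReal_map_neg, neg_zero]
  have h1 : ((gaussianReal 0 (1 / 2)).prod (gaussianReal 0 (1 / 2))).map
      (Prod.map (fun x : ℝ => -x) (fun x : ℝ => -x)) =
      (gaussianReal 0 (1 / 2)).prod (gaussianReal 0 (1 / 2)) := by
    rw [← Measure.map_prod_map _ _ (by fun_prop) (by fun_prop), h0]
  rw [cn_eq_map, Measure.map_map (by fun_prop) (by fun_prop)]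
  conv_rhs => rw [← h1]
  rw [Measure.map_map (by fun_prop) (by fun_prop)]
  congr 1

theorem map_neg_cnVec (r : ℕ) : (cnVec r).map (fun z => -z) = cnVec r := by
  have h1 : (Measure.pi fun _ : Fin r => cn).map (fun x i => -x i) =
      Measure.pi fun _ : Fin r => cn := by
    rw [Measure.pi_map_pi (fun _ => by fun_prop), map_neg_cn]
  unfold cnVec
  rw [Measure.map_map (by fun_prop) (by fun_prop)]
  conv_rhs => rw [← h1]
  rw [Measure.map_map (by fun_prop) (by fun_prop)]
  rfl

theorem integral_id_cnVec (r : ℕ) : ∫ y, y ∂cnVec r = 0 :=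
  integral_id_eq_zero_of_map_neg (map_neg_cnVec r)

theorem gaussianPDF_half_le_one (x : ℝ) : gaussianPDF 0 (1 / 2) x ≤ 1 := by
  unfold gaussianPDF
  rw [ENNReal.ofReal_le_one]
  unfold gaussianPDFReal
  refine mul_le_one₀ ?_ (Real.exp_nonneg _) ?_
  · refine inv_le_one_of_one_le₀ (Real.one_le_sqrt.2 ?_)
    have := Real.pi_gt_three
    norm_num
    linarith
  · rw [Real.exp_le_one_iff]
    exact div_nonpos_of_nonpos_of_nonneg (by nlinarith [sq_nonneg (x - 0)]) (by positivity)

/-- At variance $1/2$ the density is $e^{-x^2}/\sqrt\pi\le1$, so Lebesgue measure dominates with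
constant one. -/
theorem gaussianReal_half_le : gaussianReal 0 (1 / 2) ≤ volume := by
  rw [gaussianReal_of_var_ne_zero _ (by norm_num)]
  calc volume.withDensity (gaussianPDF 0 (1 / 2)) ≤ volume.withDensity 1 :=
        withDensity_mono (ae_of_all _ gaussianPDF_half_le_one)
    _ = volume := withDensity_one

theorem gaussianReal_abs_sub_le (a t : ℝ) :
    gaussianReal 0 (1 / 2) {x | |x - a| ≤ t} ≤ ENNReal.ofReal (2 * t) := by
  refine (gaussianReal_half_le _).trans ?_
  have : {x | |x - a| ≤ t} = Metric.closedBall a t := by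
    ext x; simp [Real.dist_eq]
  rw [this, Real.volume_closedBall]

theorem cn_closedBall_le (a : ℂ) {t : ℝ} (ht : 0 ≤ t) :
    cn {z | ‖z - a‖ ≤ t} ≤ ENNReal.ofReal (4 * t ^ 2) := by
  rw [cn_eq_map, Measure.map_apply (by fun_prop) (measurableSet_le (by fun_prop) (by fun_prop))]
  calc _ ≤ ((gaussianReal 0 (1 / 2)).prod (gaussianReal 0 (1 / 2)))
        ({x | |x - a.re| ≤ t} ×ˢ {x | |x - a.im| ≤ t}) := by
        refine measure_mono fun p hp => ?_
        simp only [Set.mem_preimage, Set.mem_ofPred_eq] at hp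
        refine ⟨?_, ?_⟩
        · simpa using (Complex.abs_re_le_norm _).trans hp
        · simpa using (Complex.abs_im_le_norm _).trans hp
    _ ≤ ENNReal.ofReal (2 * t) * ENNReal.ofReal (2 * t) := by
        rw [Measure.prod_prod]
        gcongr <;> exact gaussianReal_abs_sub_le _ _
    _ = _ := by rw [← ENNReal.ofReal_mul (by positivity)]; congr 1; ring

/-- The ball lies in the product of discs of the same radius. The exponent $r$ on $t^2$ is the
source of the factor $r$ in the diversity order. -/
theorem cnVec_norm_le_le (r : ℕ) {t : ℝ} (ht : 0 ≤ t) :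
    cnVec r {y | ‖y‖ ≤ t} ≤ ENNReal.ofReal (4 * t ^ 2) ^ r := by
  unfold cnVec
  rw [Measure.map_apply (by fun_prop) (measurableSet_le (by fun_prop) (by fun_prop))]
  calc _ ≤ (Measure.pi fun _ : Fin r => cn) (Set.univ.pi fun _ => {z : ℂ | ‖z - 0‖ ≤ t}) := by
        refine measure_mono fun p hp => ?_
        simp only [Set.mem_preimage, Set.mem_ofPred_eq] at hp
        intro i _
        simpa using (PiLp.norm_apply_le (WithLp.toLp 2 p) i).trans hp
    _ = ∏ _i : Fin r, cn {z : ℂ | ‖z - 0‖ ≤ t} := Measure.pi_pi _ _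
    _ ≤ _ := by
        rw [Finset.prod_const, Finset.card_univ, Fintype.card_fin]
        gcongr
        exact cn_closedBall_le 0 ht

theorem lintegral_enorm_rpow_neg_gaussianReal {q : ℝ} (hq0 : 0 ≤ q) (hq : q < 1) :
    ∫⁻ x, ‖x‖ₑ ^ (-q) ∂gaussianReal 0 (1 / 2) < ∞ := by
  have hint : IntegrableOn (fun x : ℝ => ‖x‖ ^ (-q)) (Set.Icc (-1) 1) := by
    have h1 : IntervalIntegrable (fun x : ℝ => ‖x‖ ^ (-q)) volume 0 1 := by
      refine (intervalIntegral.intervalIntegrable_rpow' (r := -q) (by linarith)).congr ?_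
      intro x hx
      rw [Set.uIoc_of_le zero_le_one] at hx
      simp only [Real.norm_eq_abs, abs_of_pos hx.1]
    have h2 : IntervalIntegrable (fun x : ℝ => ‖x‖ ^ (-q)) volume (-1) 0 := by
      have := (IntervalIntegrable.iff_comp_neg).1 h1
      simpa using this.symm
    rw [integrableOn_Icc_iff_integrableOn_Ioc,
      ← intervalIntegrable_iff_integrableOn_Ioc_of_le (by norm_num)]
    exact h2.trans h1
  have h1 : ∫⁻ x in Set.Icc (-1 : ℝ) 1, ‖x‖ₑ ^ (-q) < ∞ := by
    have := hint.2
    refine lt_of_eq_of_lt ?_ this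
    refine lintegral_congr_ae ?_
    have h0 : ∀ᵐ x : ℝ ∂(volume.restrict (Set.Icc (-1 : ℝ) 1)), x ≠ 0 :=
      ae_restrict_of_ae (Measure.ae_ne volume 0)
    filter_upwards [h0] with x hx
    rw [Real.enorm_eq_ofReal (Real.rpow_nonneg (norm_nonneg x) _),
      ← ENNReal.ofReal_rpow_of_pos (norm_pos_iff.2 hx), ofReal_norm]
  calc ∫⁻ x, ‖x‖ₑ ^ (-q) ∂gaussianReal 0 (1 / 2)
      ≤ ∫⁻ x, ((Set.Icc (-1 : ℝ) 1).indicator (fun x => ‖x‖ₑ ^ (-q)) x + 1)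
          ∂gaussianReal 0 (1 / 2) := by
        refine lintegral_mono fun x => ?_
        by_cases hx : x ∈ Set.Icc (-1 : ℝ) 1
        · rw [Set.indicator_of_mem hx]; exact le_self_add
        · rw [Set.indicator_of_notMem hx, zero_add, ENNReal.rpow_neg, ENNReal.inv_le_one]
          rw [← ENNReal.one_rpow q]
          refine ENNReal.rpow_le_rpow ?_ hq0
          rw [Real.enorm_eq_ofReal_abs, ENNReal.one_le_ofReal]
          rw [Set.mem_Icc, ← abs_le] at hx
          linarith
    _ = (∫⁻ x, (Set.Icc (-1 : ℝ) 1).indicator (fun x => ‖x‖ₑ ^ (-q)) x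
          ∂gaussianReal 0 (1 / 2)) + 1 := by
        rw [lintegral_add_right _ measurable_const, lintegral_one, measure_univ]
    _ ≤ (∫⁻ x, (Set.Icc (-1 : ℝ) 1).indicator (fun x => ‖x‖ₑ ^ (-q)) x) + 1 :=
        add_le_add (lintegral_mono' gaussianReal_half_le le_rfl) le_rfl
    _ < ∞ := by
        rw [lintegral_indicator measurableSet_Icc]
        exact ENNReal.add_lt_top.2 ⟨h1, ENNReal.one_lt_top⟩

/-- Both coordinates are bounded by the modulus, so $|z|^{-2q}\le|\Re z|^{-q}|\Im z|^{-q}$. This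
splits into two independent one-dimensional integrals, each finite for $q<1$. -/
theorem lintegral_enorm_rpow_neg_cn {q : ℝ} (hq0 : 0 ≤ q) (hq : q < 1) :
    ∫⁻ z, ‖z‖ₑ ^ (-(2 * q)) ∂cn < ∞ := by
  rw [cn_eq_map, lintegral_map (by fun_prop) (by fun_prop)]
  calc _ ≤ ∫⁻ p : ℝ × ℝ, ‖p.1‖ₑ ^ (-q) * ‖p.2‖ₑ ^ (-q)
          ∂((gaussianReal 0 (1 / 2)).prod (gaussianReal 0 (1 / 2))) := by
        have h0 : ∀ᵐ p : ℝ × ℝ ∂((gaussianReal 0 (1 / 2)).prod (gaussianReal 0 (1 / 2))),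
            p.1 ≠ 0 := by
          have : ∀ᵐ x ∂gaussianReal 0 (1 / 2), x ≠ 0 :=
            (Measure.absolutelyContinuous_of_le gaussianReal_half_le).ae_le
              (Measure.ae_ne volume 0)
          exact Measure.quasiMeasurePreserving_fst.ae this
        refine lintegral_mono_ae ?_
        filter_upwards [h0] with p hp
        set z := Complex.equivRealProdCLM.symm p with hz
        have hre : z.re = p.1 := by simp [hz]
        have him : z.im = p.2 := by simp [hz]
        have hz0 : z ≠ 0 := fun h => hp (by rw [← hre, h, Complex.zero_re])
        have e : ‖z‖ₑ ^ (-(2 * q)) = ‖z‖ₑ ^ (-q) * ‖z‖ₑ ^ (-q) := by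
          rw [← ENNReal.rpow_add _ _ (enorm_ne_zero.2 hz0) enorm_ne_top]; congr 1; ring
        rw [e, ENNReal.rpow_neg, ENNReal.rpow_neg, ENNReal.rpow_neg]
        gcongr
        · rw [← hre, Real.enorm_eq_ofReal_abs, ← ofReal_norm]
          exact ENNReal.ofReal_le_ofReal (Complex.abs_re_le_norm z)
        · rw [← him, Real.enorm_eq_ofReal_abs, ← ofReal_norm]
          exact ENNReal.ofReal_le_ofReal (Complex.abs_im_le_norm z)
    _ < ∞ := by
        rw [lintegral_prod_mul (f := fun x : ℝ => ‖x‖ₑ ^ (-q)) (g := fun x : ℝ => ‖x‖ₑ ^ (-q))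
          (by fun_prop) (by fun_prop)]
        exact ENNReal.mul_lt_top (lintegral_enorm_rpow_neg_gaussianReal hq0 hq)
          (lintegral_enorm_rpow_neg_gaussianReal hq0 hq)

theorem lintegral_enorm_rpow_neg_cnVec {r : ℕ} {s : ℝ} (hs0 : 0 ≤ s) (hs : s < r) :
    ∫⁻ y, ‖y‖ₑ ^ (-(2 * s)) ∂cnVec r < ∞ := by
  have hr : (0 : ℝ) < r := hs0.trans_lt hs
  unfold cnVec
  rw [lintegral_map (by fun_prop) (by fun_prop)]
  -- Splitting the exponent evenly bounds $\|y\|^{-2s}$ by $\prod_i|y_i|^{-2s/r}$, so independence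
  -- reduces the claim to one entry; $s<r$ is exactly $q<1$.
  set q := s / r
  have hq0 : 0 ≤ q := by positivity
  have hq : q < 1 := (div_lt_one hr).2 hs
  calc _ ≤ ∫⁻ p : Fin r → ℂ, ∏ i, ‖p i‖ₑ ^ (-(2 * q)) ∂Measure.pi fun _ => cn := by
        refine lintegral_mono fun p => ?_
        have e : ‖WithLp.toLp 2 p‖ₑ ^ (-(2 * s)) =
            ∏ _i : Fin r, ‖WithLp.toLp 2 p‖ₑ ^ (-(2 * q)) := by
          rw [Finset.prod_const, Finset.card_univ, Fintype.card_fin, ← ENNReal.rpow_natCast,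
            ← ENNReal.rpow_mul]
          congr 1
          simp only [q]
          field_simp
        rw [e]
        refine Finset.prod_le_prod' fun i _ => ?_
        rw [ENNReal.rpow_neg, ENNReal.rpow_neg]
        gcongr
        rw [← ofReal_norm, ← ofReal_norm]
        exact ENNReal.ofReal_le_ofReal (PiLp.norm_apply_le (WithLp.toLp 2 p) i)
    _ = ∏ i : Fin r, ∫⁻ p : Fin r → ℂ, ‖p i‖ₑ ^ (-(2 * q)) ∂Measure.pi fun _ => cn := by
        refine lintegral_prod_eq_prod_lintegral_of_indepFun _
          (fun i (p : Fin r → ℂ) => ‖p i‖ₑ ^ (-(2 * q))) ?_ (fun i => by fun_prop)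
        exact iIndepFun_pi (X := fun _ (z : ℂ) => ‖z‖ₑ ^ (-(2 * q))) fun _ => by fun_prop
    _ < ∞ := by
        refine ENNReal.prod_lt_top fun i _ => ?_
        rw [(measurePreserving_eval (fun _ : Fin r => cn) i).lintegral_comp
          (f := fun z : ℂ => ‖z‖ₑ ^ (-(2 * q))) (by fun_prop)]
        exact lintegral_enorm_rpow_neg_cn hq0 hq

end GaussianFacts

/-! ### Marginal laws, independence, and the rotation of channel and noise. -/

section Laws

variable {r : ℕ} {Ω : Type*} [MeasurableSpace Ω] {μ : Measure Ω} {S : Signals r Ω}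

namespace Signals.IsRayleigh

theorem law_h_w₁_wA (hS : S.IsRayleigh μ) :
    μ.map (fun ω => (S.h ω, S.w₁ ω, S.wA ω)) = (cnVec r).prod ((cnVec r).prod cn) := by
  have m1 := hS.measurable_h
  have m2 := hS.measurable_w₁
  have m3 := hS.measurable_wA
  have m4 := hS.measurable_w₂
  have m5 := hS.measurable_x
  have m6 := hS.measurable_w₃
  have hp : MeasurePreserving (Prod.map id (Prod.map id Prod.fst))
      ((cnVec r).prod ((cnVec r).prod (cn.prod ((cnVec r).prod (cn.prod (cnVec r))))))
      ((cnVec r).prod ((cnVec r).prod cn)) :=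
    (MeasurePreserving.id _).prod ((MeasurePreserving.id _).prod measurePreserving_fst)
  rw [← hp.map_eq, ← hS.law, Measure.map_map hp.measurable (by fun_prop)]
  rfl

theorem law_tail (hS : S.IsRayleigh μ) :
    μ.map (fun ω => (S.wA ω, S.w₂ ω, S.x ω, S.w₃ ω)) =
      cn.prod ((cnVec r).prod (cn.prod (cnVec r))) := by
  have m1 := hS.measurable_h
  have m2 := hS.measurable_w₁
  have m3 := hS.measurable_wA
  have m4 := hS.measurable_w₂
  have m5 := hS.measurable_x
  have m6 := hS.measurable_w₃
  have hp : MeasurePreserving (Prod.snd ∘ Prod.snd)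
      ((cnVec r).prod ((cnVec r).prod (cn.prod ((cnVec r).prod (cn.prod (cnVec r))))))
      (cn.prod ((cnVec r).prod (cn.prod (cnVec r)))) :=
    measurePreserving_snd.comp measurePreserving_snd
  rw [← hp.map_eq, ← hS.law, Measure.map_map hp.measurable (by fun_prop)]
  rfl

theorem law_h (hS : S.IsRayleigh μ) : μ.map S.h = cnVec r := by
  have m1 := hS.measurable_h
  have m2 := hS.measurable_w₁
  have m3 := hS.measurable_wA
  rw [← (measurePreserving_fst (μ := cnVec r) (ν := (cnVec r).prod cn)).map_eq,
    ← hS.law_h_w₁_wA, Measure.map_map measurable_fst (by fun_prop)]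
  rfl

theorem law_wA (hS : S.IsRayleigh μ) : μ.map S.wA = cn := by
  have m3 := hS.measurable_wA
  have m4 := hS.measurable_w₂
  have m5 := hS.measurable_x
  have m6 := hS.measurable_w₃
  rw [← (measurePreserving_fst (μ := cn) (ν := (cnVec r).prod (cn.prod (cnVec r)))).map_eq,
    ← hS.law_tail, Measure.map_map measurable_fst (by fun_prop)]
  rfl

theorem law_tail' (hS : S.IsRayleigh μ) :
    μ.map (fun ω => (S.w₂ ω, S.x ω, S.w₃ ω)) = (cnVec r).prod (cn.prod (cnVec r)) := by
  have m3 := hS.measurable_wA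
  have m4 := hS.measurable_w₂
  have m5 := hS.measurable_x
  have m6 := hS.measurable_w₃
  rw [← (measurePreserving_snd (μ := cn) (ν := (cnVec r).prod (cn.prod (cnVec r)))).map_eq,
    ← hS.law_tail, Measure.map_map measurable_snd (by fun_prop)]
  rfl

theorem law_w₂ (hS : S.IsRayleigh μ) : μ.map S.w₂ = cnVec r := by
  have m4 := hS.measurable_w₂
  have m5 := hS.measurable_x
  have m6 := hS.measurable_w₃
  rw [← (measurePreserving_fst (μ := cnVec r) (ν := cn.prod (cnVec r))).map_eq,
    ← hS.law_tail', Measure.map_map measurable_fst (by fun_prop)]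
  rfl

theorem law_x_w₃ (hS : S.IsRayleigh μ) :
    μ.map (fun ω => (S.x ω, S.w₃ ω)) = cn.prod (cnVec r) := by
  have m4 := hS.measurable_w₂
  have m5 := hS.measurable_x
  have m6 := hS.measurable_w₃
  rw [← (measurePreserving_snd (μ := cnVec r) (ν := cn.prod (cnVec r))).map_eq,
    ← hS.law_tail', Measure.map_map measurable_snd (by fun_prop)]
  rfl

theorem law_x (hS : S.IsRayleigh μ) : μ.map S.x = cn := by
  have m5 := hS.measurable_x
  have m6 := hS.measurable_w₃
  rw [← (measurePreserving_fst (μ := cn) (ν := cnVec r)).map_eq,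
    ← hS.law_x_w₃, Measure.map_map measurable_fst (by fun_prop)]
  rfl

theorem law_w₃ (hS : S.IsRayleigh μ) : μ.map S.w₃ = cnVec r := by
  have m5 := hS.measurable_x
  have m6 := hS.measurable_w₃
  rw [← (measurePreserving_snd (μ := cn) (ν := cnVec r)).map_eq,
    ← hS.law_x_w₃, Measure.map_map measurable_snd (by fun_prop)]
  rfl

theorem indepFun_x [IsProbabilityMeasure μ] (hS : S.IsRayleigh μ) :
    IndepFun (fun ω => (S.h ω, S.w₁ ω, S.wA ω, S.w₂ ω)) S.x μ := by
  have m1 := hS.measurable_h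
  have m2 := hS.measurable_w₁
  have m3 := hS.measurable_wA
  have m4 := hS.measurable_w₂
  have m5 := hS.measurable_x
  have m6 := hS.measurable_w₃
  have hp : MeasurePreserving
      (fun p : CVec r × CVec r × ℂ × CVec r × ℂ × CVec r =>
        ((p.1, p.2.1, p.2.2.1, p.2.2.2.1), p.2.2.2.2.1))
      ((cnVec r).prod ((cnVec r).prod (cn.prod ((cnVec r).prod (cn.prod (cnVec r))))))
      (((cnVec r).prod ((cnVec r).prod (cn.prod (cnVec r)))).prod cn) := by
    have b1 : MeasurePreserving (Prod.map (id : CVec r → CVec r) (Prod.fst : ℂ × CVec r → ℂ))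
      ((cnVec r).prod (cn.prod (cnVec r))) ((cnVec r).prod cn) :=
        (MeasurePreserving.id _).prod measurePreserving_fst
    have b2 := ((MeasurePreserving.id cn).prod b1)
    have b2' := ((measurePreserving_prodAssoc cn (cnVec r) cn).symm).comp b2
    have b3 := (MeasurePreserving.id (cnVec r)).prod b2'
    have b3' := ((measurePreserving_prodAssoc (cnVec r) (cn.prod (cnVec r)) cn).symm).comp b3
    have b4 := (MeasurePreserving.id (cnVec r)).prod b3'
    exact ((measurePreserving_prodAssoc (cnVec r) ((cnVec r).prod (cn.prod (cnVec r)))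
      cn).symm).comp b4
  have hlaw : μ.map (fun ω => ((S.h ω, S.w₁ ω, S.wA ω, S.w₂ ω), S.x ω)) =
      ((cnVec r).prod ((cnVec r).prod (cn.prod (cnVec r)))).prod cn := by
    rw [← hp.map_eq, ← hS.law, Measure.map_map hp.measurable (by fun_prop)]
    rfl
  refine (indepFun_iff_map_prod_eq_prod_map_map (by fun_prop) (by fun_prop)).2 ?_
  rw [hlaw, hS.law_x]
  congr 1
  rw [← (measurePreserving_fst (μ := (cnVec r).prod ((cnVec r).prod (cn.prod (cnVec r))))
    (ν := cn)).map_eq, ← hlaw, Measure.map_map measurable_fst (by fun_prop)]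
  rfl

theorem memLp_of_law {E : Type*} [NormedAddCommGroup E] [NormedSpace ℝ E] [MeasurableSpace E]
    [BorelSpace E] [SecondCountableTopology E] [CompleteSpace E] {X : Ω → E} (hX : Measurable X)
    {ν : Measure E} [IsGaussian ν] (h : μ.map X = ν) {p : ℝ≥0∞} (hp : p ≠ ∞) :
    MemLp X p μ := by
  have := IsGaussian.memLp_id ν p hp
  rw [← h] at this
  exact (memLp_map_measure_iff this.1 hX.aemeasurable).1 this

/-- The received training signal of phase I and the residual, normalized to `CN(0, 1)` entries. -/
theorem exists_rotation (hS : S.IsRayleigh μ) {β : ℝ} :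
    ∃ Y Z : Ω → CVec r, Measurable Y ∧ Measurable Z ∧
      μ.map (fun ω => (Y ω, Z ω, S.wA ω)) = (cnVec r).prod ((cnVec r).prod cn) ∧
      (∀ ω, Y ω = (Real.sqrt (1 + β ^ 2))⁻¹ • ((β : ℂ) • S.h ω + S.w₁ ω)) ∧
      ∀ ω, S.h ω = (β / Real.sqrt (1 + β ^ 2)) • Y ω - (1 / Real.sqrt (1 + β ^ 2)) • Z ω := by
  have m1 := hS.measurable_h
  have m2 := hS.measurable_w₁
  have m3 := hS.measurable_wA
  set n := Real.sqrt (1 + β ^ 2) with hn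
  have hn0 : 0 < n := Real.sqrt_pos.2 (by positivity)
  have hn2 : n ^ 2 = 1 + β ^ 2 := Real.sq_sqrt (by positivity)
  obtain ⟨θ, hc, hs⟩ : ∃ θ : ℝ, Real.cos θ = β / n ∧ Real.sin θ = 1 / n := by
    have hnorm : ‖(⟨β / n, 1 / n⟩ : ℂ)‖ = 1 := by
      rw [Complex.norm_eq_sqrt_sq_add_sq, Real.sqrt_eq_one]
      field_simp
      linarith
    refine ⟨Complex.arg ⟨β / n, 1 / n⟩, ?_, ?_⟩
    · have := Complex.norm_mul_cos_arg ⟨β / n, 1 / n⟩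
      rwa [hnorm, one_mul] at this
    · have := Complex.norm_mul_sin_arg ⟨β / n, 1 / n⟩
      rwa [hnorm, one_mul] at this
  -- The product of two copies of a centred Gaussian law is invariant under rotation. The angle is
  -- chosen so that the first rotated component is proportional to the training signal of phase I.
  have hrot := IsGaussian.map_rotation_eq_self (μ := cnVec r) (integral_id_cnVec r) θ
  have hsq : (β / n) * (β / n) + (1 / n) * (1 / n) = 1 := by
    field_simp; linarith
  refine ⟨fun ω => (β / n) • S.h ω + (1 / n) • S.w₁ ω,
    fun ω => -(1 / n) • S.h ω + (β / n) • S.w₁ ω, by fun_prop, by fun_prop, ?_, ?_, ?_⟩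
  · have hp1 : MeasurePreserving (ContinuousLinearMap.rotation (E := CVec r) θ)
      ((cnVec r).prod (cnVec r)) ((cnVec r).prod (cnVec r)) := ⟨by fun_prop, hrot⟩
    have hp := (measurePreserving_prodAssoc (cnVec r) (cnVec r) cn).comp
      ((hp1.prod (MeasurePreserving.id cn)).comp
        (measurePreserving_prodAssoc (cnVec r) (cnVec r) cn).symm)
    rw [← hp.map_eq, ← hS.law_h_w₁_wA, Measure.map_map hp.measurable (by fun_prop)]
    congr 1
    ext1 ω
    simp [MeasurableEquiv.prodAssoc, ContinuousLinearMap.rotation_apply, hc, hs]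
  · intro ω
    simp only [smul_add, Complex.coe_smul, smul_smul, one_div]
    rw [div_eq_inv_mul]
  · intro ω
    have : S.h ω = ((β / n) * (β / n) + (1 / n) * (1 / n)) • S.h ω := by rw [hsq, one_smul]
    rw [this]
    module

end Signals.IsRayleigh

end Laws

/-! ### Measurability of the protocol's signals, and two-sided bounds on $\hat\sigma$. -/

section Training

variable {r : ℕ} {Ω : Type*} [MeasurableSpace Ω] {μ : Measure Ω} {S : Signals r Ω}

/-- Doob–Dynkin factorization. It makes every estimate a function of the signals received before,
from which measurability and the independence of $\hat{\mathbf p}_c$ from $x$ follow. -/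
theorem mmse_factors {E F : Type*} [NormedAddCommGroup E] [NormedSpace ℝ E] [CompleteSpace E]
    [MeasurableSpace E] [BorelSpace E] [SecondCountableTopology E] [MeasurableSpace F]
    (μ : Measure Ω) (X : Ω → E) (Y : Ω → F) : ∃ f : F → E, Measurable f ∧ mmse μ X Y = f ∘ Y := by
  have h : StronglyMeasurable[MeasurableSpace.comap Y inferInstance] (mmse μ X Y) :=
    stronglyMeasurable_condExp
  have := h.measurable
  exact this.exists_eq_measurable_comp

theorem hHat_factors (μ : Measure Ω) (S : Signals r Ω) (Q : Params) (P : ℝ) :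
    ∃ f : CVec r → CVec r, Measurable f ∧ ∀ ω, hHat μ S Q P ω = f (y₁ S Q P ω) := by
  obtain ⟨f, hf, h⟩ := mmse_factors μ S.h (y₁ S Q P)
  exact ⟨f, hf, fun ω => congrFun h ω⟩

theorem sigmaHat_factors (μ : Measure Ω) (S : Signals r Ω) (Q : Params) (P : ℝ) :
    ∃ f : CVec r × CVec r × ℂ → ℝ, Measurable f ∧
      ∀ ω, sigmaHat μ S Q P ω = f (S.h ω, S.w₁ ω, S.wA ω) := by
  obtain ⟨f, hf, h⟩ := hHat_factors μ S Q P
  refine ⟨fun p => (inner ℂ p.1 (((Real.sqrt (P * Q.LB) : ℝ) : ℂ) •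
    (((‖f (((Real.sqrt (P * Q.L₁) : ℝ) : ℂ) • p.1 + p.2.1)‖⁻¹ : ℝ) : ℂ) •
      f (((Real.sqrt (P * Q.L₁) : ℝ) : ℂ) • p.1 + p.2.1))) + p.2.2).re / Real.sqrt (P * Q.LB),
      ?_, fun ω => ?_⟩
  · have h1 : Measurable fun p : CVec r × CVec r × ℂ =>
      f (((Real.sqrt (P * Q.L₁) : ℝ) : ℂ) • p.1 + p.2.1) := by fun_prop
    have h2 : Measurable fun p : CVec r × CVec r × ℂ =>
      (((Real.sqrt (P * Q.LB) : ℝ) : ℂ) •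
    (((‖f (((Real.sqrt (P * Q.L₁) : ℝ) : ℂ) • p.1 + p.2.1)‖⁻¹ : ℝ) : ℂ) •
      f (((Real.sqrt (P * Q.L₁) : ℝ) : ℂ) • p.1 + p.2.1))) := by fun_prop
    exact (Complex.measurable_re.comp ((measurable_fst.inner h2).add
      (measurable_snd.comp measurable_snd))).div_const _
  · simp only [sigmaHat, yA, xB, vHat, h, y₁]

theorem measurable_power (Q : Params) (P : ℝ) : Measurable (power Q P) := by
  unfold power Φ
  refine Measurable.ite (measurableSet_le measurable_id measurable_const) measurable_const ?_
  fun_prop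

theorem y₂n_factors (μ : Measure Ω) (S : Signals r Ω) (Q : Params) (P : ℝ) :
    ∃ f : CVec r × CVec r × ℂ × CVec r → CVec r, Measurable f ∧
      ∀ ω, y₂n μ S Q P ω = f (S.h ω, S.w₁ ω, S.wA ω, S.w₂ ω) := by
  obtain ⟨f, hf, h⟩ := sigmaHat_factors μ S Q P
  have hp := measurable_power Q P
  refine ⟨fun p => (((Real.sqrt (P * Q.L₂))⁻¹ : ℝ) : ℂ) • (((Real.sqrt (P * Q.L₂) *
    Real.sqrt (power Q P (f (p.1, p.2.1, p.2.2.1))) : ℝ) : ℂ) • p.1 + p.2.2.2), by fun_prop,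
    fun ω => ?_⟩
  simp only [y₂n, y₂, txPower, h]

theorem pcHat_factors (μ : Measure Ω) (S : Signals r Ω) (Q : Params) (P : ℝ) :
    ∃ f : CVec r × CVec r × ℂ × CVec r → CVec r, Measurable f ∧
      ∀ ω, pcHat μ S Q P ω = f (S.h ω, S.w₁ ω, S.wA ω, S.w₂ ω) := by
  obtain ⟨f, hf, h⟩ := mmse_factors μ (pc μ S Q P) (y₂n μ S Q P)
  obtain ⟨g, hg, h'⟩ := y₂n_factors μ S Q P
  exact ⟨f ∘ g, hf.comp hg, fun ω => (congrFun h ω).trans (by simp [h'])⟩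

theorem measurable_sigmaHat (hS : S.IsRayleigh μ) (Q : Params) (P : ℝ) :
    Measurable (sigmaHat μ S Q P) := by
  obtain ⟨f, hf, h⟩ := sigmaHat_factors μ S Q P
  have := hS.measurable_h; have := hS.measurable_w₁; have := hS.measurable_wA
  rw [funext h]; fun_prop

theorem measurable_txPower (hS : S.IsRayleigh μ) (Q : Params) (P : ℝ) :
    Measurable (txPower μ S Q P) :=
  (measurable_power Q P).comp (measurable_sigmaHat hS Q P)

theorem measurable_pc (hS : S.IsRayleigh μ) (Q : Params) (P : ℝ) :
    Measurable (pc μ S Q P) := by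
  have := hS.measurable_h; have := measurable_txPower hS Q P
  unfold pc; fun_prop

theorem measurable_y₂n (hS : S.IsRayleigh μ) (Q : Params) (P : ℝ) :
    Measurable (y₂n μ S Q P) := by
  obtain ⟨f, hf, h⟩ := y₂n_factors μ S Q P
  have := hS.measurable_h; have := hS.measurable_w₁; have := hS.measurable_wA
  have := hS.measurable_w₂
  rw [funext h]; fun_prop

theorem measurable_pcHat (hS : S.IsRayleigh μ) (Q : Params) (P : ℝ) :
    Measurable (pcHat μ S Q P) := by
  obtain ⟨f, hf, h⟩ := pcHat_factors μ S Q P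
  have := hS.measurable_h; have := hS.measurable_w₁; have := hS.measurable_wA
  have := hS.measurable_w₂
  rw [funext h]; fun_prop

theorem measurable_yd (hS : S.IsRayleigh μ) (Q : Params) (P : ℝ) :
    Measurable (yd μ S Q P) := by
  have := hS.measurable_h; have := hS.measurable_x; have := hS.measurable_w₃
  have := measurable_txPower hS Q P
  unfold yd; fun_prop

theorem measurable_y₁ (hS : S.IsRayleigh μ) (Q : Params) (P : ℝ) :
    Measurable (y₁ S Q P) := by
  have := hS.measurable_h; have := hS.measurable_w₁
  unfold y₁; fun_prop

theorem indepFun_x_pcHat [IsProbabilityMeasure μ] (hS : S.IsRayleigh μ) (Q : Params) (P : ℝ) :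
    IndepFun (pcHat μ S Q P) S.x μ := by
  obtain ⟨f, hf, h⟩ := pcHat_factors μ S Q P
  rw [funext h]
  exact hS.indepFun_x.comp hf measurable_id

theorem norm_vHat_le (μ : Measure Ω) (S : Signals r Ω) (Q : Params) (P : ℝ) (ω : Ω) :
    ‖vHat μ S Q P ω‖ ≤ 1 := by
  unfold vHat
  rw [norm_smul, Complex.norm_real, norm_inv, norm_norm]
  exact inv_mul_le_one

theorem sigmaHat_eq (μ : Measure Ω) (S : Signals r Ω) (Q : Params) {P : ℝ} (hP : 0 < P)
    (hLB : 1 ≤ Q.LB) (ω : Ω) : sigmaHat μ S Q P ω =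
      (inner ℂ (S.h ω) (vHat μ S Q P ω)).re + (S.wA ω).re / Real.sqrt (P * Q.LB) := by
  have : 0 < Real.sqrt (P * Q.LB) := Real.sqrt_pos.2 (by positivity)
  unfold sigmaHat yA xB
  rw [inner_smul_right, Complex.add_re, Complex.re_ofReal_mul, add_div]
  field_simp

theorem abs_wA_div_le {Ω' : Type*} (S : Signals r Ω') (Q : Params) {P : ℝ} (hP : 0 < P)
    (hLB : 1 ≤ Q.LB) (ω : Ω') :
    |(S.wA ω).re / Real.sqrt (P * Q.LB)| ≤ ‖S.wA ω‖ / Real.sqrt P := by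
  rw [abs_div, abs_of_nonneg (Real.sqrt_nonneg _)]
  have : 0 < Real.sqrt P := Real.sqrt_pos.2 hP
  gcongr
  · exact Complex.abs_re_le_norm _
  · have : (1 : ℝ) ≤ Q.LB := by exact_mod_cast hLB
    nlinarith

theorem sigmaHat_le (μ : Measure Ω) (S : Signals r Ω) (Q : Params) {P : ℝ} (hP : 0 < P)
    (hLB : 1 ≤ Q.LB) (ω : Ω) :
    sigmaHat μ S Q P ω ≤ ‖S.h ω‖ + ‖S.wA ω‖ / Real.sqrt P := by
  rw [sigmaHat_eq μ S Q hP hLB]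
  refine add_le_add ?_ ((le_abs_self _).trans (abs_wA_div_le S Q hP hLB ω))
  calc _ ≤ ‖inner ℂ (S.h ω) (vHat μ S Q P ω)‖ := Complex.re_le_norm _
    _ ≤ ‖S.h ω‖ * ‖vHat μ S Q P ω‖ := norm_inner_le_norm _ _
    _ ≤ ‖S.h ω‖ * 1 := by gcongr; exact norm_vHat_le μ S Q P ω
    _ = _ := mul_one _

/-- With $\beta=\sqrt{PL_{A,\tau_1}}$ and $n=\sqrt{1+\beta^2}$, $\mathbf y_1=nY$ and $\mathbf
h=(\beta Y-Z)/n$ with $Z$ centred and independent of $Y$. So $\hat{\mathbf h}=(\beta/n)Y$ and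
$\hat{\mathbf v}$ is the direction of $Y$. The projection of $\mathbf h$ on it is $(\beta/n)\|Y\|$
minus at most $\|Z\|/n$. -/
theorem exists_sigmaHat_ge [IsProbabilityMeasure μ] (hS : S.IsRayleigh μ) (Q : Params) {P : ℝ}
    (hP : 1 ≤ P) (hL₁ : 1 ≤ Q.L₁) (hLB : 1 ≤ Q.LB) :
    ∃ Y Z : Ω → CVec r, Measurable Y ∧ Measurable Z ∧
      μ.map (fun ω => (Y ω, Z ω, S.wA ω)) = (cnVec r).prod ((cnVec r).prod cn) ∧
      ∀ᵐ ω ∂μ, ‖Y ω‖ / 2 - (‖Z ω‖ + ‖S.wA ω‖) / Real.sqrt P ≤ sigmaHat μ S Q P ω := by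
  have hP0 : 0 < P := by linarith
  have hL : (1 : ℝ) ≤ Q.L₁ := by exact_mod_cast hL₁
  set β := Real.sqrt (P * Q.L₁) with hβ
  have hβ0 : 0 < β := Real.sqrt_pos.2 (by positivity)
  have hβ2 : β ^ 2 = P * Q.L₁ := Real.sq_sqrt (by positivity)
  obtain ⟨Y, Z, mY, mZ, hlaw, hY, hh⟩ := hS.exists_rotation (β := β)
  refine ⟨Y, Z, mY, mZ, hlaw, ?_⟩
  set n := Real.sqrt (1 + β ^ 2) with hn
  have hn0 : 0 < n := Real.sqrt_pos.2 (by positivity)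
  have hn2 : n ^ 2 = 1 + β ^ 2 := Real.sq_sqrt (by positivity)
  have mwA := hS.measurable_wA
  have lY : μ.map Y = cnVec r := by
    rw [← (measurePreserving_fst (μ := cnVec r) (ν := (cnVec r).prod cn)).map_eq, ← hlaw,
      Measure.map_map measurable_fst (by fun_prop)]
    rfl
  have lZA : μ.map (fun ω => (Z ω, S.wA ω)) = (cnVec r).prod cn := by
    rw [← (measurePreserving_snd (μ := cnVec r) (ν := (cnVec r).prod cn)).map_eq, ← hlaw,
      Measure.map_map measurable_snd (by fun_prop)]
    rfl
  have lZ : μ.map Z = cnVec r := by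
    rw [← (measurePreserving_fst (μ := cnVec r) (ν := cn)).map_eq, ← lZA,
      Measure.map_map measurable_fst (by fun_prop)]
    rfl
  have iY : Integrable Y μ :=
    memLp_one_iff_integrable.1 (Signals.IsRayleigh.memLp_of_law mY lY ENNReal.one_ne_top)
  have iZ : Integrable Z μ :=
    memLp_one_iff_integrable.1 (Signals.IsRayleigh.memLp_of_law mZ lZ ENNReal.one_ne_top)
  have hind : IndepFun Z Y μ := by
    have h1 : IndepFun Y (fun ω => (Z ω, S.wA ω)) μ := by
      refine (indepFun_iff_map_prod_eq_prod_map_map (by fun_prop) (by fun_prop)).2 ?_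
      rw [hlaw, lY, lZA]
    exact (h1.comp measurable_id measurable_fst).symm
  have hy₁ : ∀ ω, y₁ S Q P ω = n • Y ω := by
    intro ω
    rw [hY ω, smul_smul, mul_inv_cancel₀ hn0.ne', one_smul]
    rfl
  have my := measurable_y₁ hS Q P
  have hZ0 : μ[Z | MeasurableSpace.comap (y₁ S Q P) inferInstance] =ᵐ[μ] fun _ => 0 := by
    have hi : IndepFun Z (y₁ S Q P) μ := by
      rw [funext hy₁]
      exact hind.comp measurable_id (measurable_const_smul n)
    have := condExp_indep_eq (μ := μ) mZ.comap_le my.comap_le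
      (comap_measurable Z).stronglyMeasurable hi
    refine this.trans (ae_of_all _ fun _ => ?_)
    rw [← integral_map (f := fun z => z) mZ.aemeasurable (by fun_prop), lZ]
    exact integral_id_cnVec r
  have hYc : μ[Y | MeasurableSpace.comap (y₁ S Q P) inferInstance] = Y := by
    refine condExp_of_stronglyMeasurable my.comap_le ?_ iY
    have : Y = (fun z => n⁻¹ • z) ∘ y₁ S Q P := by
      ext1 ω
      rw [Function.comp_apply, hy₁ ω, smul_smul, inv_mul_cancel₀ hn0.ne', one_smul]
    rw [this]
    exact ((measurable_const_smul n⁻¹).comp (comap_measurable _)).stronglyMeasurable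
  have hhat : ∀ᵐ ω ∂μ, hHat μ S Q P ω = (β / n) • Y ω := by
    have e : S.h = (β / n) • Y - (1 / n) • Z := by ext1 ω; exact hh ω
    have h1 := condExp_sub (iY.smul (β / n)) (iZ.smul (1 / n))
      (MeasurableSpace.comap (y₁ S Q P) inferInstance)
    have h2 := condExp_smul (μ := μ) (β / n) Y
      (MeasurableSpace.comap (y₁ S Q P) inferInstance)
    have h3 := condExp_smul (μ := μ) (1 / n) Z
      (MeasurableSpace.comap (y₁ S Q P) inferInstance)
    rw [← e] at h1
    filter_upwards [h1, h2, h3, hZ0] with ω e1 e2 e3 e4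
    rw [hHat, mmse, e1, Pi.sub_apply, e2, e3, Pi.smul_apply, Pi.smul_apply, e4, hYc, smul_zero,
      sub_zero]
  filter_upwards [hhat] with ω hω
  rw [sigmaHat_eq μ S Q hP0 hLB]
  -- Here $\beta^2\ge1$, hence $n^2\le2\beta^2$.
  have hc : 1 / 2 ≤ β / n := by
    rw [div_le_div_iff₀ two_pos hn0, one_mul]
    refine abs_le_of_sq_le_sq' ?_ (by positivity) |>.2
    nlinarith
  have hsn : 1 / n ≤ 1 / Real.sqrt P := by
    refine one_div_le_one_div_of_le (Real.sqrt_pos.2 hP0) ?_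
    rw [hn]
    refine Real.sqrt_le_sqrt ?_
    nlinarith
  have hv : vHat μ S Q P ω = ‖Y ω‖⁻¹ • Y ω := by
    have : 0 < β / n := by positivity
    rw [vHat, hω, norm_smul, Complex.coe_smul, smul_smul, Real.norm_of_nonneg this.le, mul_inv]
    congr 1
    field_simp
  have hYY : (inner ℂ (Y ω) (‖Y ω‖⁻¹ • Y ω)).re = ‖Y ω‖ := by
    rw [← Complex.coe_smul, inner_smul_right, inner_self_eq_norm_sq_to_K]
    by_cases h0 : ‖Y ω‖ = 0
    · simp [h0]
    · rw [Complex.re_ofReal_mul]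
      norm_cast
      field_simp
      exact Complex.ofReal_re _
  have hZY : (inner ℂ (Z ω) (‖Y ω‖⁻¹ • Y ω)).re ≤ ‖Z ω‖ := by
    rw [← hv]
    calc _ ≤ ‖inner ℂ (Z ω) (vHat μ S Q P ω)‖ := Complex.re_le_norm _
    _ ≤ ‖Z ω‖ * ‖vHat μ S Q P ω‖ := norm_inner_le_norm _ _
    _ ≤ ‖Z ω‖ * 1 := by gcongr; exact norm_vHat_le μ S Q P ω
    _ = _ := mul_one _
  have hin : (inner ℂ (S.h ω) (vHat μ S Q P ω)).re =
      (β / n) * ‖Y ω‖ - (1 / n) * (inner ℂ (Z ω) (‖Y ω‖⁻¹ • Y ω)).re := by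
    rw [hv, hh ω, inner_sub_left, Complex.sub_re]
    conv_lhs => rw [← Complex.coe_smul (β / n), ← Complex.coe_smul (1 / n)]
    rw [inner_smul_left, inner_smul_left, Complex.conj_ofReal, Complex.conj_ofReal,
      Complex.re_ofReal_mul, Complex.re_ofReal_mul, hYY]
  have hA := neg_le_of_abs_le (abs_wA_div_le S Q hP0 hLB ω)
  have h1 : ‖Y ω‖ / 2 ≤ (β / n) * ‖Y ω‖ := by
    have := mul_le_mul_of_nonneg_right hc (norm_nonneg (Y ω))
    linarith
  have h2 : (1 / n) * (inner ℂ (Z ω) (‖Y ω‖⁻¹ • Y ω)).re ≤ ‖Z ω‖ / Real.sqrt P := by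
    calc _ ≤ (1 / n) * ‖Z ω‖ := by gcongr
      _ ≤ (1 / Real.sqrt P) * ‖Z ω‖ := by gcongr
      _ = _ := by ring
  rw [hin, add_div]
  linarith

end Training

/-! ### The average power constraint and the choice of $c$ and $\kappa_P$. -/

section PowerNormalization

variable {r : ℕ} {Ω : Type*} [MeasurableSpace Ω] {μ : Measure Ω} {S : Signals r Ω}

theorem _root_.ENNReal.inv_le_inv_mul_of_le_mul {a y n : ℝ≥0∞} (hn : n ≠ 0) (hn' : n ≠ ∞)
    (h : y ≤ a * n) : a⁻¹ ≤ y⁻¹ * n := by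
  have h1 : (a * n)⁻¹ ≤ y⁻¹ := ENNReal.inv_le_inv.2 h
  calc a⁻¹ = (a * n)⁻¹ * n := by
        rw [ENNReal.mul_inv (Or.inr hn') (Or.inr hn), mul_assoc, ENNReal.inv_mul_cancel hn hn',
          mul_one]
    _ ≤ y⁻¹ * n := by gcongr

theorem lintegral_noise_rpow_lt_top (r : ℕ) {p : ℝ} (hp : 0 < p) :
    ∫⁻ q : CVec r × ℂ, ENNReal.ofReal (2 * (1 + ‖q.1‖ + ‖q.2‖)) ^ p ∂((cnVec r).prod cn) < ∞ := by
  have h1 : MemLp (fun q : CVec r × ℂ => q) (ENNReal.ofReal p) ((cnVec r).prod cn) :=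
    IsGaussian.memLp_id _ _ ENNReal.ofReal_ne_top
  have h2 : MemLp (fun q : CVec r × ℂ => 2 * (1 + ‖q.1‖ + ‖q.2‖)) (ENNReal.ofReal p)
      ((cnVec r).prod cn) := by
    refine (((memLp_const (1 : ℝ)).add (h1.norm.add h1.norm)).const_mul 2).of_le (by fun_prop)
      (ae_of_all _ fun q => ?_)
    have h3 := norm_fst_le q
    have h4 := norm_snd_le q
    rw [Real.norm_of_nonneg (by positivity)]
    refine le_trans ?_ (Real.le_norm_self _)
    simp only [Pi.add_apply]
    linarith
  have h3 := lintegral_rpow_enorm_lt_top_of_eLpNorm_lt_top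
    (ENNReal.ofReal_pos.2 hp).ne' ENNReal.ofReal_ne_top h2.2
  rw [ENNReal.toReal_ofReal hp.le] at h3
  refine lt_of_eq_of_lt (lintegral_congr fun q => ?_) h3
  rw [Real.enorm_eq_ofReal (by positivity)]

/-- The maximum lets one inequality serve both sides of the threshold: below it $y$ is of order
$P^{-1/2}$, above it $y$ is of order $\sigma$, each up to a noise factor with all moments. -/
theorem norm_le_sigma_mul {y σ n P : ℝ}
    (h : y / 2 - n / Real.sqrt P ≤ σ) : y ≤ max σ (1 / Real.sqrt P) * (2 * (1 + n)) ∨ n < 0 := by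
  by_cases hn : n < 0
  · exact Or.inr hn
  left
  push Not at hn
  have h1 := le_max_left σ (1 / Real.sqrt P)
  have h2 := le_max_right σ (1 / Real.sqrt P)
  have h3 := mul_le_mul_of_nonneg_left h2 hn
  have : n / Real.sqrt P = n * (1 / Real.sqrt P) := by ring
  nlinarith

/-- Below the threshold $\|Y\|\le P^{-1/2}$ times a noise factor independent of $Y$. Conditioning on
that factor, the small-ball bound gives $P^{-r}$ times a finite moment. The constant is uniform in
the parameters, so it can be used to choose $c$ afterwards. -/
theorem exists_measure_sigmaHat_le [IsProbabilityMeasure μ] (hS : S.IsRayleigh μ) (hr : 0 < r) :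
    ∃ C : ℝ, 0 < C ∧ ∀ (Q : Params) (P : ℝ), 1 ≤ P → 1 ≤ Q.L₁ → 1 ≤ Q.LB →
      μ.real {ω | sigmaHat μ S Q P ω ≤ 1 / Real.sqrt P} ≤ C * P ^ (-(r : ℝ)) := by
  have hfin := lintegral_noise_rpow_lt_top r (p := 2 * r) (by positivity)
  set I := ∫⁻ q : CVec r × ℂ, ENNReal.ofReal (2 * (1 + ‖q.1‖ + ‖q.2‖)) ^ (2 * r : ℝ)
    ∂((cnVec r).prod cn)
  refine ⟨4 ^ r * (I.toReal + 1), by positivity, fun Q P hP hL₁ hLB => ?_⟩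
  have hP0 : 0 < P := by linarith
  obtain ⟨Y, Z, mY, mZ, hlaw, hae⟩ := exists_sigmaHat_ge hS Q hP hL₁ hLB
  have mwA := hS.measurable_wA
  have key : μ {ω | sigmaHat μ S Q P ω ≤ 1 / Real.sqrt P} ≤
      ENNReal.ofReal (4 ^ r * P ^ (-(r : ℝ))) * I := by
    set A : Set (CVec r × CVec r × ℂ) :=
      {p | ‖p.1‖ ≤ 1 / Real.sqrt P * (2 * (1 + ‖p.2.1‖ + ‖p.2.2‖))} with hA
    have mA : MeasurableSet A := measurableSet_le (by fun_prop) (by fun_prop)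
    calc μ {ω | sigmaHat μ S Q P ω ≤ 1 / Real.sqrt P}
        ≤ μ ((fun ω => (Y ω, Z ω, S.wA ω)) ⁻¹' A) := by
          refine measure_mono_ae ?_
          filter_upwards [hae] with ω hω hσ
          have hσ' : sigmaHat μ S Q P ω ≤ 1 / Real.sqrt P := hσ
          rcases norm_le_sigma_mul hω with h | h
          · rw [max_eq_right hσ', ← add_assoc] at h
            exact h
          · linarith [norm_nonneg (Z ω), norm_nonneg (S.wA ω)]
      _ = ((cnVec r).prod ((cnVec r).prod cn)) A := by
          rw [← hlaw, Measure.map_apply (by fun_prop) mA]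
      _ = ∫⁻ q, cnVec r ((fun x => (x, q)) ⁻¹' A) ∂((cnVec r).prod cn) :=
          Measure.prod_apply_symm mA
      _ ≤ ∫⁻ q : CVec r × ℂ, ENNReal.ofReal (4 ^ r * P ^ (-(r : ℝ))) *
            ENNReal.ofReal (2 * (1 + ‖q.1‖ + ‖q.2‖)) ^ (2 * r : ℝ) ∂((cnVec r).prod cn) := by
          refine lintegral_mono fun q => ?_
          refine (cnVec_norm_le_le r (t := 1 / Real.sqrt P * (2 * (1 + ‖q.1‖ + ‖q.2‖)))
            (by positivity)).trans (le_of_eq ?_)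
          rw [ENNReal.ofReal_rpow_of_nonneg (by positivity) (by positivity),
            ← ENNReal.ofReal_mul (by positivity), ← ENNReal.ofReal_pow (by positivity)]
          congr 1
          generalize hm : 2 * (1 + ‖q.1‖ + ‖q.2‖) = m
          have hm0 : 0 ≤ m := by rw [← hm]; positivity
          have e : (1 / Real.sqrt P * m) ^ 2 = m ^ 2 / P := by
            rw [mul_pow, div_pow, Real.sq_sqrt hP0.le]; ring
          rw [e, Real.rpow_neg hP0.le, Real.rpow_natCast, Real.rpow_mul hm0, Real.rpow_natCast,
            Real.rpow_ofNat, mul_pow, div_pow]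
          ring
      _ = _ := by
          rw [lintegral_const_mul _ (by fun_prop)]
  have hnn : 0 ≤ 4 ^ r * P ^ (-(r : ℝ)) := by positivity
  calc μ.real {ω | sigmaHat μ S Q P ω ≤ 1 / Real.sqrt P}
      ≤ (ENNReal.ofReal (4 ^ r * P ^ (-(r : ℝ))) * I).toReal :=
        ENNReal.toReal_mono (ENNReal.mul_ne_top ENNReal.ofReal_ne_top hfin.ne) key
    _ = 4 ^ r * P ^ (-(r : ℝ)) * I.toReal := by
        rw [ENNReal.toReal_mul, ENNReal.toReal_ofReal hnn]
    _ ≤ 4 ^ r * P ^ (-(r : ℝ)) * (I.toReal + 1) := by gcongr; linarith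
    _ = _ := by ring

/-- The inverse power of the channel estimate, cut off at the threshold. -/
noncomputable def invSigma (μ : Measure Ω) (S : Signals r Ω) (Q : Params) (P : ℝ) (ω : Ω) : ℝ :=
  if sigmaHat μ S Q P ω ≤ 1 / Real.sqrt P then 0 else (sigmaHat μ S Q P ω ^ (2 * Q.s))⁻¹

theorem measurable_invSigma (hS : S.IsRayleigh μ) (Q : Params) (P : ℝ) :
    Measurable (invSigma μ S Q P) := by
  have := measurable_sigmaHat hS Q P
  unfold invSigma
  exact Measurable.ite (measurableSet_le this measurable_const) measurable_const (by fun_prop)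

theorem invSigma_nonneg (μ : Measure Ω) (S : Signals r Ω) (Q : Params) (P : ℝ) (ω : Ω) :
    0 ≤ invSigma μ S Q P ω := by
  unfold invSigma
  split_ifs with h
  · rfl
  · have : 0 ≤ 1 / Real.sqrt P := by positivity
    have : 0 ≤ sigmaHat μ S Q P ω := by linarith
    positivity

/-- The threshold keeps the transmit power bounded for each fixed $P$, which makes the composite
channel integrable. -/
theorem invSigma_le (μ : Measure Ω) (S : Signals r Ω) (Q : Params) (hs : 0 ≤ Q.s) {P : ℝ}
    (hP : 0 < P) (ω : Ω) : invSigma μ S Q P ω ≤ P ^ Q.s := by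
  unfold invSigma
  split_ifs with h
  · positivity
  · push Not at h
    have h0 : 0 < 1 / Real.sqrt P := by positivity
    have h1 : (1 / Real.sqrt P) ^ (2 * Q.s) ≤ sigmaHat μ S Q P ω ^ (2 * Q.s) :=
      Real.rpow_le_rpow h0.le h.le (by positivity)
    refine (inv_anti₀ (by positivity) h1).trans (le_of_eq ?_)
    rw [Real.rpow_mul h0.le, Real.rpow_ofNat, div_pow, Real.sq_sqrt hP.le, one_pow, one_div,
      Real.inv_rpow hP.le, inv_inv]

theorem integrable_invSigma [IsProbabilityMeasure μ] (hS : S.IsRayleigh μ) (Q : Params)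
    (hs : 0 ≤ Q.s) {P : ℝ} (hP : 0 < P) : Integrable (invSigma μ S Q P) μ :=
  Integrable.of_bound (measurable_invSigma hS Q P).aestronglyMeasurable (P ^ Q.s)
    (ae_of_all _ fun ω => by
      rw [Real.norm_of_nonneg (invSigma_nonneg μ S Q P ω)]
      exact invSigma_le μ S Q hs hP ω)

/-- Above the threshold $\hat\sigma^{-2s}$ is at most $\|Y\|^{-2s}$ times the $2s$-th power of an
independent noise factor, so the mean is bounded by a product of two integrals that do not involve
$P$. -/
theorem exists_integral_invSigma_le [IsProbabilityMeasure μ] (hS : S.IsRayleigh μ) {s : ℝ}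
    (hs0 : 0 < s) (hsr : s < r) :
    ∃ C : ℝ, 0 < C ∧ ∀ (Q : Params) (P : ℝ), Q.s = s → 1 ≤ P → 1 ≤ Q.L₁ → 1 ≤ Q.LB →
      ∫ ω, invSigma μ S Q P ω ∂μ ≤ C := by
  have hfin := lintegral_noise_rpow_lt_top r (p := 2 * s) (by positivity)
  have hfin' := lintegral_enorm_rpow_neg_cnVec hs0.le hsr
  set I := ∫⁻ q : CVec r × ℂ, ENNReal.ofReal (2 * (1 + ‖q.1‖ + ‖q.2‖)) ^ (2 * s)
    ∂((cnVec r).prod cn)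
  set J := ∫⁻ y, ‖y‖ₑ ^ (-(2 * s)) ∂cnVec r
  refine ⟨(J * I).toReal + 1, by positivity, fun Q P hQs hP hL₁ hLB => ?_⟩
  have hP0 : 0 < P := by linarith
  obtain ⟨Y, Z, mY, mZ, hlaw, hae⟩ := exists_sigmaHat_ge hS Q hP hL₁ hLB
  have mwA := hS.measurable_wA
  rw [integral_eq_lintegral_of_nonneg_ae (ae_of_all _ (invSigma_nonneg μ S Q P))
    (measurable_invSigma hS Q P).aestronglyMeasurable]
  refine le_trans ?_ (le_add_of_nonneg_right zero_le_one)
  refine ENNReal.toReal_mono (ENNReal.mul_lt_top hfin' hfin).ne ?_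
  calc ∫⁻ ω, ENNReal.ofReal (invSigma μ S Q P ω) ∂μ
      ≤ ∫⁻ ω, (fun p : CVec r × CVec r × ℂ => ‖p.1‖ₑ ^ (-(2 * s)) *
          ENNReal.ofReal (2 * (1 + ‖p.2.1‖ + ‖p.2.2‖)) ^ (2 * s)) (Y ω, Z ω, S.wA ω) ∂μ := by
        refine lintegral_mono_ae ?_
        filter_upwards [hae] with ω hω
        simp only [invSigma]
        split_ifs with h
        · simp
        push Not at h
        have h0 : 0 < 1 / Real.sqrt P := by positivity
        have hσ := h0.trans h
        rcases norm_le_sigma_mul hω with hy | hy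
        · rw [max_eq_left h.le, ← add_assoc] at hy
          set σ := sigmaHat μ S Q P ω
          set n := 2 * (1 + ‖Z ω‖ + ‖S.wA ω‖)
          have hn : 0 < n := by positivity
          have hy' : ‖Y ω‖ₑ ≤ ENNReal.ofReal σ * ENNReal.ofReal n := by
            rw [← ofReal_norm, ← ENNReal.ofReal_mul hσ.le]
            exact ENNReal.ofReal_le_ofReal hy
          have hy2 : ‖Y ω‖ₑ ^ (2 * s) ≤
              ENNReal.ofReal σ ^ (2 * s) * ENNReal.ofReal n ^ (2 * s) := by
            rw [← ENNReal.mul_rpow_of_nonneg _ _ (by positivity)]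
            exact ENNReal.rpow_le_rpow hy' (by positivity)
          rw [hQs, ENNReal.ofReal_inv_of_pos (by positivity),
            ← ENNReal.ofReal_rpow_of_pos hσ, ENNReal.rpow_neg]
          have hnpos : ENNReal.ofReal n ^ (2 * s) ≠ 0 :=
            (ENNReal.rpow_pos (ENNReal.ofReal_pos.2 hn) ENNReal.ofReal_ne_top).ne'
          have hntop : ENNReal.ofReal n ^ (2 * s) ≠ ∞ :=
            ENNReal.rpow_ne_top_of_nonneg (by positivity) ENNReal.ofReal_ne_top
          exact ENNReal.inv_le_inv_mul_of_le_mul hnpos hntop hy2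
        · linarith [norm_nonneg (Z ω), norm_nonneg (S.wA ω)]
    _ = ∫⁻ p : CVec r × CVec r × ℂ, ‖p.1‖ₑ ^ (-(2 * s)) *
          ENNReal.ofReal (2 * (1 + ‖p.2.1‖ + ‖p.2.2‖)) ^ (2 * s)
          ∂((cnVec r).prod ((cnVec r).prod cn)) := by
        rw [← hlaw, lintegral_map (by fun_prop) (by fun_prop)]
    _ = J * I := lintegral_prod_mul (f := fun y : CVec r => ‖y‖ₑ ^ (-(2 * s)))
        (g := fun q : CVec r × ℂ => ENNReal.ofReal (2 * (1 + ‖q.1‖ + ‖q.2‖)) ^ (2 * s))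
        (by fun_prop) (by fun_prop)

theorem txPower_eq (μ : Measure Ω) (S : Signals r Ω) (Q : Params) (P : ℝ) (ω : Ω) :
    txPower μ S Q P ω =
      {ω | sigmaHat μ S Q P ω ≤ 1 / Real.sqrt P}.indicator (fun _ => Q.c * P ^ Q.l) ω +
      Q.κ P * (Real.exp (Q.R P / Q.α) - 1) * invSigma μ S Q P ω := by
  unfold txPower power invSigma Φ Set.indicator
  simp only [Set.mem_ofPred_eq]
  split_ifs with h
  · simp
  · simp only [zero_add]
    ring

theorem integral_txPower [IsProbabilityMeasure μ] (hS : S.IsRayleigh μ) (Q : Params)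
    (hs : 0 ≤ Q.s) {P : ℝ} (hP : 0 < P) :
    ∫ ω, txPower μ S Q P ω ∂μ =
      μ.real {ω | sigmaHat μ S Q P ω ≤ 1 / Real.sqrt P} * (Q.c * P ^ Q.l) +
      Q.κ P * (Real.exp (Q.R P / Q.α) - 1) * ∫ ω, invSigma μ S Q P ω ∂μ := by
  have hm : MeasurableSet {ω | sigmaHat μ S Q P ω ≤ 1 / Real.sqrt P} :=
    measurableSet_le (measurable_sigmaHat hS Q P) measurable_const
  simp_rw [txPower_eq]
  rw [integral_add ((integrable_const _).indicator hm)
    ((integrable_invSigma hS Q hs hP).const_mul _), integral_indicator hm, setIntegral_const,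
    smul_eq_mul, integral_const_mul]

theorem integral_invSigma_pos [IsProbabilityMeasure μ] (hS : S.IsRayleigh μ) (Q : Params)
    (hs : 0 ≤ Q.s) {P : ℝ} (hP : 0 < P)
    (h : μ.real {ω | sigmaHat μ S Q P ω ≤ 1 / Real.sqrt P} < 1) :
    0 < ∫ ω, invSigma μ S Q P ω ∂μ := by
  rw [integral_pos_iff_support_of_nonneg (invSigma_nonneg μ S Q P)
    (integrable_invSigma hS Q hs hP)]
  have hm : MeasurableSet {ω | sigmaHat μ S Q P ω ≤ 1 / Real.sqrt P} :=
    measurableSet_le (measurable_sigmaHat hS Q P) measurable_const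
  have hsub : {ω | sigmaHat μ S Q P ω ≤ 1 / Real.sqrt P}ᶜ ⊆
      Function.support (invSigma μ S Q P) := by
    intro ω hω
    have hω' : ¬ sigmaHat μ S Q P ω ≤ 1 / Real.sqrt P := hω
    have h0 : 0 < 1 / Real.sqrt P := by positivity
    have : 0 < sigmaHat μ S Q P ω := by linarith
    rw [Function.mem_support, invSigma, if_neg hω']
    positivity
  refine lt_of_lt_of_le ?_ (measure_mono hsub)
  rw [pos_iff_ne_zero]
  intro h0
  have : μ.real {ω | sigmaHat μ S Q P ω ≤ 1 / Real.sqrt P}ᶜ = 0 := by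
    rw [Measure.real, h0, ENNReal.toReal_zero]
  rw [probReal_compl_eq_one_sub hm] at this
  linarith

/-- The power normalization that meets the average power constraint. -/
theorem exists_normalization [IsProbabilityMeasure μ] (hS : S.IsRayleigh μ)
    (Lc L₁ LB L₂ : ℕ) (hL₁ : 1 ≤ L₁) (hLB : 1 ≤ LB) {l s : ℝ} (hlr : l ≤ r) (hs : 0 < s)
    (hsr : s < r) (hα : 0 < dataFraction Lc L₁ LB L₂) (R : ℝ → ℝ) (hR : ∀ᶠ P in atTop, 0 < R P) :
    ∃ (c : ℝ) (κ : ℝ → ℝ) (k : ℝ), 0 < c ∧ (l < r → c = 1) ∧ 0 < k ∧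
      let Q : Params :=
        { Lc := Lc, L₁ := L₁, LB := LB, L₂ := L₂, l := l, s := s, c := c, κ := κ, R := R }
      ∀ᶠ P in atTop, 0 < κ P ∧ ∫ ω, txPower μ S Q P ω ∂μ = 1 ∧
        k ≤ κ P * (Real.exp (R P / Q.α) - 1) := by
  have hr : 0 < r := by
    have : (0 : ℝ) < r := hs.trans hsr
    exact_mod_cast this
  have hr' : (0 : ℝ) < r := by exact_mod_cast hr
  obtain ⟨C₁, hC₁, h₁⟩ := exists_measure_sigmaHat_le hS hr
  obtain ⟨C₂, hC₂, h₂⟩ := exists_integral_invSigma_le hS hs hsr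
  -- For $l<r$ the power spent below the threshold vanishes like $P^{l-r}$. For $l=r$ it stays of
  -- constant order, and this $c$ caps it at half of the budget.
  let c : ℝ := if l < r then 1 else 1 / (2 * C₁)
  have hc : 0 < c := by
    simp only [c]; split_ifs <;> positivity
  let Q₀ : Params :=
    { Lc := Lc, L₁ := L₁, LB := LB, L₂ := L₂, l := l, s := s, c := c, κ := 0, R := R }
  let p : ℝ → ℝ := fun P => μ.real {ω | sigmaHat μ S Q₀ P ω ≤ 1 / Real.sqrt P}
  let B : ℝ → ℝ := fun P => ∫ ω, invSigma μ S Q₀ P ω ∂μ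
  refine ⟨c, fun P => (1 - p P * (c * P ^ l)) / ((Real.exp (R P / Q₀.α) - 1) * B P),
    1 / (2 * C₂), hc, fun h => if_pos h, by positivity, ?_⟩
  have hpc : ∀ᶠ P in atTop, p P * (c * P ^ l) ≤ 1 / 2 := by
    have hbound : ∀ᶠ P : ℝ in atTop, C₁ * P ^ (-(r : ℝ)) * (c * P ^ l) ≤ 1 / 2 := by
      by_cases hl : l < r
      · have ht : Tendsto (fun P : ℝ => C₁ * c * P ^ (-(r - l))) atTop (𝓝 (C₁ * c * 0)) :=
          (tendsto_rpow_neg_atTop (by linarith)).const_mul _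
        rw [mul_zero] at ht
        filter_upwards [ht.eventually_le_const (show (0 : ℝ) < 1 / 2 by norm_num),
          eventually_gt_atTop 0] with P hP hP0
        refine le_trans (le_of_eq ?_) hP
        rw [show -(r - l) = -(r : ℝ) + l by ring, Real.rpow_add hP0]
        ring
      · have hlr' : l = r := le_antisymm hlr (not_lt.1 hl)
        have hcc : c = 1 / (2 * C₁) := if_neg hl
        filter_upwards [eventually_gt_atTop 0] with P hP0
        rw [hcc, hlr', Real.rpow_neg hP0.le]
        have : 0 < P ^ (r : ℝ) := by positivity
        refine le_of_eq ?_
        field_simp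
    filter_upwards [hbound, eventually_ge_atTop 1] with P hP hP1
    refine le_trans ?_ hP
    have : 0 ≤ c * P ^ l := by positivity
    exact mul_le_mul_of_nonneg_right (h₁ Q₀ P hP1 hL₁ hLB) this
  have hp1 : ∀ᶠ P in atTop, p P < 1 := by
    have ht : Tendsto (fun P : ℝ => C₁ * P ^ (-(r : ℝ))) atTop (𝓝 (C₁ * 0)) :=
      (tendsto_rpow_neg_atTop hr').const_mul _
    rw [mul_zero] at ht
    filter_upwards [ht.eventually_lt_const (zero_lt_one), eventually_ge_atTop 1] with P hP hP1
    exact (h₁ Q₀ P hP1 hL₁ hLB).trans_lt hP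
  intro Q
  filter_upwards [hpc, hp1, hR, eventually_ge_atTop 1] with P h1 h2' h3 h4
  have hP0 : 0 < P := by linarith
  have hB : 0 < B P := integral_invSigma_pos hS Q₀ hs.le hP0 h2'
  have hB2 : B P ≤ C₂ := h₂ Q₀ P rfl h4 hL₁ hLB
  have hE : 0 < Real.exp (R P / Q₀.α) - 1 := by
    have : 0 < R P / Q₀.α := div_pos h3 hα
    linarith [Real.add_one_lt_exp this.ne']
  have hK : Q.κ P * (Real.exp (R P / Q₀.α) - 1) = (1 - p P * (c * P ^ l)) / B P := by
    simp only [Q]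
    field_simp
  refine ⟨div_pos (by linarith) (by positivity), ?_, ?_⟩
  · rw [integral_txPower hS Q hs.le hP0]
    change p P * (c * P ^ l) + Q.κ P * (Real.exp (R P / Q₀.α) - 1) * B P = 1
    rw [hK]
    field_simp
    ring
  · refine le_trans ?_ hK.ge
    rw [div_le_div_iff₀ (by positivity) hB]
    nlinarith

end PowerNormalization

/-! ### Probabilities that decay faster than every power of $P$. -/

section Negligible

/-- Decay faster than every power of `P`. -/
def Negligible (p : ℝ → ℝ≥0∞) : Prop :=
  ∀ N : ℝ, ∀ᶠ P in atTop, p P ≤ ENNReal.ofReal (P ^ (-N))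

theorem eventually_const_le_rpow (C : ℝ) {ε : ℝ} (hε : 0 < ε) : ∀ᶠ P : ℝ in atTop, C ≤ P ^ ε :=
  (tendsto_rpow_atTop hε).eventually_ge_atTop C

theorem Negligible.const_mul {p : ℝ → ℝ≥0∞} (hp : Negligible p) {C : ℝ≥0∞} (hC : C ≠ ∞) :
    Negligible fun P => C * p P := by
  intro N
  filter_upwards [hp (N + 1), eventually_ge_atTop C.toReal, eventually_gt_atTop 0] with P h1 h2 h3
  calc C * p P ≤ ENNReal.ofReal P * ENNReal.ofReal (P ^ (-(N + 1))) := by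
        gcongr
        rwa [← ENNReal.ofReal_toReal hC, ENNReal.ofReal_le_ofReal_iff h3.le]
    _ = _ := by
        rw [← ENNReal.ofReal_mul h3.le]
        congr 1
        rw [neg_add, Real.rpow_add h3, Real.rpow_neg_one]
        field_simp

theorem Negligible.mono {p q : ℝ → ℝ≥0∞} (hp : Negligible p) (h : ∀ᶠ P in atTop, q P ≤ p P) :
    Negligible q := fun N => by
  filter_upwards [hp N, h] with P h1 h2 using h2.trans h1

theorem Negligible.add {p q : ℝ → ℝ≥0∞} (hp : Negligible p) (hq : Negligible q) :
    Negligible fun P => p P + q P := by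
  have : Negligible fun P => max (p P) (q P) := fun N => by
    filter_upwards [hp N, hq N] with P h1 h2 using max_le h1 h2
  refine (this.const_mul (C := 2) (by simp)).mono (Eventually.of_forall fun P => ?_)
  rw [two_mul]
  exact add_le_add (le_max_left _ _) (le_max_right _ _)

variable {Ω : Type*} [MeasurableSpace Ω] {μ : Measure Ω}

/-- Markov's inequality with an arbitrarily high moment; only bounds uniform in $P$ are needed, not
a fixed law. -/
theorem negligible_of_moments {E : Type*} [NormedAddCommGroup E] {f : ℝ → Ω → E}
    (hf : ∀ᶠ P in atTop, AEStronglyMeasurable (f P) μ)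
    (h : ∀ n : ℕ, 1 ≤ n → ∃ C : ℝ≥0∞, C ≠ ∞ ∧ ∀ᶠ P in atTop, eLpNorm (f P) n μ ≤ C)
    {ε : ℝ} (hε : 0 < ε) : Negligible fun P => μ {ω | P ^ ε ≤ ‖f P ω‖} := by
  intro N
  -- One power of $P$ more than required, to absorb the constant $C^n$.
  obtain ⟨n, hn⟩ := exists_nat_ge (max 1 ((N + 1) / ε))
  have hn1 : 1 ≤ n := by exact_mod_cast (le_max_left _ _).trans hn
  have hnN : N + 1 ≤ ε * n := by
    rw [← div_le_iff₀' hε]; exact (le_max_right _ _).trans hn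
  obtain ⟨C, hC, hCb⟩ := h n hn1
  have hCn : C ^ n ≠ ∞ := ENNReal.pow_ne_top hC
  filter_upwards [hf, hCb, eventually_ge_atTop 1, eventually_ge_atTop (C ^ n).toReal]
    with P h1 h2 h3 h4
  have hP : 0 < P := by linarith
  have hn0 : (n : ℝ≥0∞) ≠ 0 := by exact_mod_cast (by omega : n ≠ 0)
  have key := mul_meas_ge_le_pow_eLpNorm' μ hn0 (ENNReal.natCast_ne_top n) h1
    (ENNReal.ofReal (P ^ ε))
  simp only [ENNReal.toReal_natCast, ENNReal.rpow_natCast] at key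
  have hset : {ω | P ^ ε ≤ ‖f P ω‖} = {ω | ENNReal.ofReal (P ^ ε) ≤ ‖f P ω‖ₑ} := by
    ext ω
    simp only [Set.mem_ofPred_eq]
    rw [← ofReal_norm, ENNReal.ofReal_le_ofReal_iff (norm_nonneg _)]
  rw [hset]
  have hpos : ENNReal.ofReal (P ^ ε) ^ n ≠ 0 :=
    pow_ne_zero _ (ENNReal.ofReal_pos.2 (by positivity)).ne'
  have htop : ENNReal.ofReal (P ^ ε) ^ n ≠ ∞ := ENNReal.pow_ne_top ENNReal.ofReal_ne_top
  calc μ {ω | ENNReal.ofReal (P ^ ε) ≤ ‖f P ω‖ₑ}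
      ≤ C ^ n / ENNReal.ofReal (P ^ ε) ^ n := by
        rw [ENNReal.le_div_iff_mul_le (Or.inl hpos) (Or.inl htop), mul_comm]
        exact key.trans (by gcongr)
    _ ≤ ENNReal.ofReal P / ENNReal.ofReal (P ^ (N + 1)) := by
        gcongr
        · rwa [← ENNReal.ofReal_toReal hCn, ENNReal.ofReal_le_ofReal_iff hP.le]
        · rw [← ENNReal.ofReal_pow (by positivity), ← Real.rpow_natCast, ← Real.rpow_mul hP.le]
          exact ENNReal.ofReal_le_ofReal (Real.rpow_le_rpow_of_exponent_le h3 hnN)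
    _ = _ := by
        rw [← ENNReal.ofReal_div_of_pos (by positivity)]
        congr 1
        rw [Real.rpow_add hP, Real.rpow_one, Real.rpow_neg hP.le]
        field_simp

theorem negligible_of_memLp {E : Type*} [NormedAddCommGroup E] {f : Ω → E}
    (hf : ∀ p : ℝ≥0∞, p ≠ ∞ → MemLp f p μ)
    {ε : ℝ} (hε : 0 < ε) : Negligible fun P => μ {ω | P ^ ε ≤ ‖f ω‖} :=
  negligible_of_moments (f := fun _ => f)
    (Eventually.of_forall fun _ => (hf 0 (by simp)).1)
    (fun n _ => ⟨eLpNorm f n μ, (hf n (by simp)).2.ne, Eventually.of_forall fun _ => le_rfl⟩) hε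

end Negligible

/-! ### The error of the composite channel estimate. -/

section Estimation

variable {r : ℕ} {Ω : Type*} [MeasurableSpace Ω] {μ : Measure Ω} {S : Signals r Ω}

theorem memLp_w₂ (hS : S.IsRayleigh μ) {p : ℝ≥0∞} (hp : p ≠ ∞) : MemLp S.w₂ p μ :=
  Signals.IsRayleigh.memLp_of_law hS.measurable_w₂ hS.law_w₂ hp

theorem integrable_pc [IsProbabilityMeasure μ] (hS : S.IsRayleigh μ) (Q : Params) (hs : 0 ≤ Q.s)
    {P : ℝ} (hP : 0 < P) : Integrable (pc μ S Q P) μ := by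
  have hh : Integrable S.h μ := memLp_one_iff_integrable.1
    (Signals.IsRayleigh.memLp_of_law hS.measurable_h hS.law_h ENNReal.one_ne_top)
  have mT := measurable_txPower hS Q P
  have mP : Measurable fun ω => ((Real.sqrt (txPower μ S Q P ω) : ℝ) : ℂ) := by fun_prop
  refine hh.bdd_smul (Real.sqrt (|Q.c * P ^ Q.l| +
    |Q.κ P * (Real.exp (Q.R P / Q.α) - 1)| * P ^ Q.s)) mP.aestronglyMeasurable (ae_of_all _ fun ω => ?_)
  rw [Complex.norm_real, Real.norm_of_nonneg (Real.sqrt_nonneg _)]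
  refine Real.sqrt_le_sqrt ?_
  rw [txPower_eq]
  refine add_le_add ?_ ?_
  · unfold Set.indicator
    split_ifs
    · exact le_abs_self _
    · positivity
  · calc _ ≤ |Q.κ P * (Real.exp (Q.R P / Q.α) - 1)| * invSigma μ S Q P ω := by
          gcongr
          · exact invSigma_nonneg μ S Q P ω
          · exact le_abs_self _
      _ ≤ _ := by
          gcongr
          exact invSigma_le μ S Q hs hP ω

/-- Since $\tilde{\mathbf y}=\mathbf p_c+b^{-1}\mathbf w_2$ is known to node B, estimating $\mathbf
p_c$ amounts to estimating the noise. The error is therefore controlled by the noise alone, although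
$\mathbf p_c$ is far from Gaussian. -/
theorem pcErr_ae_eq [IsProbabilityMeasure μ] (hS : S.IsRayleigh μ) (Q : Params) (hs : 0 ≤ Q.s)
    (hL₂ : 1 ≤ Q.L₂) {P : ℝ} (hP : 0 < P) :
    ∀ᵐ ω ∂μ, Real.sqrt (P * Q.L₂) • pcErr μ S Q P ω =
      mmse μ S.w₂ (y₂n μ S Q P) ω - S.w₂ ω := by
  set b := Real.sqrt (P * Q.L₂) with hb
  have hb0 : 0 < b := Real.sqrt_pos.2 (by positivity)
  have hi := integrable_pc hS Q hs hP
  have hw : Integrable S.w₂ μ := memLp_one_iff_integrable.1 (memLp_w₂ hS ENNReal.one_ne_top)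
  have my := measurable_y₂n hS Q P
  have hy : ∀ ω, y₂n μ S Q P ω = pc μ S Q P ω + b⁻¹ • S.w₂ ω := by
    intro ω
    simp only [y₂n, y₂, pc, ← hb, Complex.coe_smul, smul_add, smul_smul]
    congr 2
    field_simp
  have hyi : Integrable (y₂n μ S Q P) μ := by
    rw [funext hy]; exact hi.add (hw.smul b⁻¹)
  have e : pc μ S Q P = y₂n μ S Q P - b⁻¹ • S.w₂ := by
    ext1 ω
    simp [hy ω]
  have h1 := condExp_sub hyi (hw.smul b⁻¹)
    (MeasurableSpace.comap (y₂n μ S Q P) inferInstance)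
  have h2 := condExp_smul (μ := μ) b⁻¹ S.w₂
    (MeasurableSpace.comap (y₂n μ S Q P) inferInstance)
  have h3 : μ[y₂n μ S Q P | MeasurableSpace.comap (y₂n μ S Q P) inferInstance] = y₂n μ S Q P :=
    condExp_of_stronglyMeasurable my.comap_le (comap_measurable _).stronglyMeasurable hyi
  rw [← e] at h1
  filter_upwards [h1, h2] with ω e1 e2
  rw [pcErr, pcHat, mmse, mmse, e1, Pi.sub_apply, e2, h3, hy ω, Pi.smul_apply]
  generalize (μ[S.w₂ | MeasurableSpace.comap (y₂n μ S Q P) inferInstance]) ω = v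
  have h5 : b • (pc μ S Q P ω - (pc μ S Q P ω + b⁻¹ • S.w₂ ω - b⁻¹ • v)) =
      (b * b⁻¹) • (v - S.w₂ ω) := by module
  rw [h5, mul_inv_cancel₀ hb0.ne', one_smul]

theorem eLpNorm_pcErr_le [IsProbabilityMeasure μ] (hS : S.IsRayleigh μ) (Q : Params) (hs : 0 ≤ Q.s)
    (hL₂ : 1 ≤ Q.L₂) {P : ℝ} (hP : 0 < P) {p : ℝ≥0∞} (hp : 1 ≤ p) :
    eLpNorm (fun ω => Real.sqrt (P * Q.L₂) • pcErr μ S Q P ω) p μ ≤ 2 * eLpNorm S.w₂ p μ := by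
  rw [eLpNorm_congr_ae (pcErr_ae_eq hS Q hs hL₂ hP)]
  refine (eLpNorm_sub_le ?_ hS.measurable_w₂.aestronglyMeasurable hp).trans ?_
  · exact (stronglyMeasurable_condExp.mono (measurable_y₂n hS Q P).comap_le).aestronglyMeasurable
  · rw [two_mul]
    gcongr
    exact eLpNorm_condExp_le_eLpNorm _ hp

/-- Conditional expectation contracts $L^p$ once more, now applied to the squared error; this
doubles the moment order. -/
theorem eLpNorm_condErr_le [IsProbabilityMeasure μ] (hS : S.IsRayleigh μ) (Q : Params)
    (hs : 0 ≤ Q.s) (hL₂ : 1 ≤ Q.L₂) {P : ℝ} (hP : 0 < P) {p : ℝ≥0∞} (hp : 1 ≤ p) :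
    eLpNorm (fun ω => (P * Q.L₂) * condErr μ S Q P ω) p μ ≤ (2 * eLpNorm S.w₂ (p * 2) μ) ^ 2 := by
  have hb : Real.sqrt (P * Q.L₂) ^ 2 = P * Q.L₂ := Real.sq_sqrt (by positivity)
  have h2 : (fun ω => (P * Q.L₂) * condErr μ S Q P ω) =ᵐ[μ]
      μ[(fun ω => ‖Real.sqrt (P * Q.L₂) • pcErr μ S Q P ω‖ ^ (2 : ℝ)) |
        MeasurableSpace.comap (y₂n μ S Q P) inferInstance] := by
    have := condExp_smul (μ := μ) (P * Q.L₂) (fun ω => ‖pcErr μ S Q P ω‖ ^ 2)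
      (MeasurableSpace.comap (y₂n μ S Q P) inferInstance)
    refine EventuallyEq.trans this.symm (Eventually.of_forall fun ω => ?_)
    congr 2
    ext1 ω
    rw [Real.rpow_ofNat, norm_smul, mul_pow, Real.norm_of_nonneg (Real.sqrt_nonneg _), hb]
    rfl
  rw [eLpNorm_congr_ae h2]
  refine (eLpNorm_condExp_le_eLpNorm _ hp).trans ?_
  rw [eLpNorm_norm_rpow _ two_pos, ENNReal.rpow_ofNat, ENNReal.ofReal_ofNat]
  gcongr
  exact eLpNorm_pcErr_le hS Q hs hL₂ hP (hp.trans (le_mul_of_one_le_right' one_le_two))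

theorem condErr_nonneg (μ : Measure Ω) (S : Signals r Ω) (Q : Params) (P : ℝ) :
    ∀ᵐ ω ∂μ, 0 ≤ condErr μ S Q P ω :=
  condExp_nonneg (ae_of_all _ fun _ => by positivity)

theorem negligible_pcErr [IsProbabilityMeasure μ] (hS : S.IsRayleigh μ) (Q : Params)
    (hs : 0 ≤ Q.s) (hL₂ : 1 ≤ Q.L₂) {ε : ℝ} (hε : 0 < ε) :
    Negligible fun P => μ {ω | P ^ ε ≤ Real.sqrt P * ‖pcErr μ S Q P ω‖} := by
  have h := negligible_of_moments (μ := μ)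
    (f := fun P ω => Real.sqrt (P * Q.L₂) • pcErr μ S Q P ω) ?_ ?_ hε
  · refine h.mono ?_
    filter_upwards [eventually_gt_atTop 0] with P hP
    refine measure_mono fun ω hω => ?_
    refine le_trans hω.out ?_
    rw [norm_smul, Real.norm_of_nonneg (Real.sqrt_nonneg _)]
    gcongr
    have : (1 : ℝ) ≤ Q.L₂ := by exact_mod_cast hL₂
    nlinarith
  · refine Eventually.of_forall fun P => ?_
    exact (((measurable_pc hS Q P).sub (measurable_pcHat hS Q P)).const_smul
      (Real.sqrt (P * Q.L₂))).aestronglyMeasurable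
  · intro n hn
    refine ⟨2 * eLpNorm S.w₂ n μ, ENNReal.mul_ne_top (by simp)
      (memLp_w₂ hS (ENNReal.natCast_ne_top n)).2.ne, ?_⟩
    filter_upwards [eventually_gt_atTop 0] with P hP
    exact eLpNorm_pcErr_le hS Q hs hL₂ hP (by exact_mod_cast hn)

theorem negligible_condErr [IsProbabilityMeasure μ] (hS : S.IsRayleigh μ) (Q : Params)
    (hs : 0 ≤ Q.s) (hL₂ : 1 ≤ Q.L₂) {ε : ℝ} (hε : 0 < ε) :
    Negligible fun P => μ {ω | P ^ ε ≤ P * condErr μ S Q P ω} := by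
  have h := negligible_of_moments (μ := μ)
    (f := fun P ω => (P * Q.L₂) * condErr μ S Q P ω) ?_ ?_ hε
  · refine h.mono ?_
    filter_upwards [eventually_gt_atTop 0] with P hP
    refine measure_mono_ae ?_
    filter_upwards [condErr_nonneg μ S Q P] with ω h0 hω
    refine le_trans (hω : P ^ ε ≤ P * condErr μ S Q P ω) ?_
    refine le_trans ?_ (Real.le_norm_self _)
    gcongr
    have : (1 : ℝ) ≤ Q.L₂ := by exact_mod_cast hL₂
    nlinarith
  · refine Eventually.of_forall fun P => ?_
    exact ((stronglyMeasurable_condExp.mono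
      (measurable_y₂n hS Q P).comap_le).aestronglyMeasurable).const_mul _
  · intro n hn
    refine ⟨(2 * eLpNorm S.w₂ (n * 2) μ) ^ 2, ENNReal.pow_ne_top (ENNReal.mul_ne_top (by simp)
      (memLp_w₂ hS (ENNReal.mul_ne_top (ENNReal.natCast_ne_top n) (by simp))).2.ne), ?_⟩
    filter_upwards [eventually_gt_atTop 0] with P hP
    exact eLpNorm_condErr_le hS Q hs hL₂ hP (by exact_mod_cast hn)

end Estimation

/-! ### Lower bounds on mutual information, and conditional laws. -/

section MutualInformation

open InformationTheory

/-- The Donsker–Varadhan lower bound on the relative entropy. -/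
theorem le_klDiv_of_integrable {X : Type*} [MeasurableSpace X] (ρ ν : Measure X)
    [IsProbabilityMeasure ρ] [IsProbabilityMeasure ν] {f : X → ℝ} (hf : Integrable f ρ)
    (hexp : Integrable (fun x => Real.exp (f x)) ν) :
    ENNReal.ofReal (∫ x, f x ∂ρ - Real.log (∫ x, Real.exp (f x) ∂ν)) ≤ klDiv ρ ν := by
  by_cases htop : klDiv ρ ν = ∞
  · rw [htop]; exact le_top
  obtain ⟨hac, hint⟩ := klDiv_ne_top_iff.1 htop
  refine ENNReal.ofReal_le_of_le_toReal ?_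
  rw [toReal_klDiv_of_measure_eq hac (by simp)]
  have : IsProbabilityMeasure (ν.tilted f) := isProbabilityMeasure_tilted hexp
  have hac' : ρ ≪ ν.tilted f := hac.trans (absolutelyContinuous_tilted hexp)
  -- Tilting $\nu$ by $f$ changes the relative entropy by $-\int f\,d\rho+\log\int e^f\,d\nu$; the
  -- tilted relative entropy is nonnegative.
  have h := integral_llr_tilted_right hac hf hexp hint
  have h0 : 0 ≤ ∫ x, llr ρ (ν.tilted f) x ∂ρ := by
    rw [← toReal_klDiv_of_measure_eq hac' (by simp)]
    exact ENNReal.toReal_nonneg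
  linarith

/-- A lower bound on the mutual information of a `CN(0, 1)` input and an output from which the
input can be recovered with accuracy `τ`, up to an event of probability `δ`. -/
theorem le_mutualInfo_of_estimator {B : Type*} [MeasurableSpace B] (ρ : Measure (ℂ × B))
    [IsProbabilityMeasure ρ] (hρ : ρ.fst = cn) {g : B → ℂ} (hg : Measurable g) {τ a δ : ℝ}
    (hτ : 0 ≤ τ) (ha : 0 ≤ a) (haτ : Real.exp a * (4 * τ ^ 2) ≤ 1)
    (hδ : ρ.real {q | τ < ‖q.1 - g q.2‖} ≤ δ) :
    ENNReal.ofReal ((1 - δ) * a - Real.log 2) ≤ mutualInfo ρ := by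
  set A : Set (ℂ × B) := {q | ‖q.1 - g q.2‖ ≤ τ} with hA
  have mA : MeasurableSet A := measurableSet_le (by fun_prop) measurable_const
  have hAc : Aᶜ = {q | τ < ‖q.1 - g q.2‖} := by ext q; simp [hA]
  have hρA : 1 - δ ≤ ρ.real A := by
    have := probReal_compl_eq_one_sub (μ := ρ) mA
    rw [hAc] at this
    linarith
  have : IsProbabilityMeasure (ρ.fst.prod ρ.snd) := by infer_instance
  have hprod : (ρ.fst.prod ρ.snd).real A ≤ 4 * τ ^ 2 := by
    refine ENNReal.toReal_le_of_le_ofReal (by positivity) ?_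
    rw [Measure.prod_apply_symm mA]
    calc _ ≤ ∫⁻ _y, ENNReal.ofReal (4 * τ ^ 2) ∂ρ.snd := by
          refine lintegral_mono fun y => ?_
          rw [hρ]
          exact cn_closedBall_le (g y) hτ
      _ = _ := by simp
  have mf : Measurable (A.indicator fun _ => a) := measurable_const.indicator mA
  have hexpf : (fun q => Real.exp (A.indicator (fun _ => a) q)) =
      fun q => A.indicator (fun _ => Real.exp a - 1) q + 1 := by
    ext q
    by_cases hq : q ∈ A <;> simp [hq]
  -- The test function is $a$ on the event of accurate recovery. Under the product law the output is
  -- independent of the input, so this event has probability at most $4\tau^2$, and the exponential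
  -- moment is at most $1+e^a\cdot4\tau^2\le2$.
  have h := le_klDiv_of_integrable ρ (ρ.fst.prod ρ.snd) (f := A.indicator fun _ => a)
    ((integrable_const a).indicator mA) (by
      rw [hexpf]
      exact ((integrable_const _).indicator mA).add (integrable_const _))
  refine le_trans (ENNReal.ofReal_le_ofReal ?_) h
  have i1 : ∫ q, A.indicator (fun _ => a) q ∂ρ = ρ.real A * a := by
    rw [integral_indicator mA, setIntegral_const, smul_eq_mul]
  have i2 : ∫ q, Real.exp (A.indicator (fun _ => a) q) ∂(ρ.fst.prod ρ.snd) =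
      (ρ.fst.prod ρ.snd).real A * (Real.exp a - 1) + 1 := by
    rw [hexpf, integral_add ((integrable_const _).indicator mA) (integrable_const _),
      integral_indicator mA, setIntegral_const, smul_eq_mul]
    simp
  rw [i1, i2]
  have hea : 0 ≤ Real.exp a - 1 := by linarith [Real.add_one_le_exp a]
  have h0 : 0 ≤ (ρ.fst.prod ρ.snd).real A := measureReal_nonneg
  have hlog : Real.log ((ρ.fst.prod ρ.snd).real A * (Real.exp a - 1) + 1) ≤ Real.log 2 := by
    refine Real.log_le_log (by positivity) ?_
    have h1 := mul_le_mul_of_nonneg_right hprod hea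
    nlinarith [sq_nonneg τ]
  have := mul_le_mul_of_nonneg_right hρA ha
  linarith

variable {Ω A B C : Type*} [MeasurableSpace Ω] [MeasurableSpace A] [StandardBorelSpace A]
  [Nonempty A] [MeasurableSpace B] [StandardBorelSpace B] [Nonempty B] [MeasurableSpace C]

/-- Conditioning on an independent variable does not change the law of the first component. -/
theorem condDistrib_prod_fst_ae_eq {μ : Measure Ω} [IsProbabilityMeasure μ] {X : Ω → A}
    {Y : Ω → B} {T : Ω → C} (hX : Measurable X) (hY : Measurable Y) (hT : Measurable T)
    (hind : IndepFun T X μ) :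
    ∀ᵐ ω ∂μ, (condDistrib (fun ω => (X ω, Y ω)) T μ (T ω)).fst = μ.map X := by
  have : IsProbabilityMeasure (μ.map X) := Measure.isProbabilityMeasure_map hX.aemeasurable
  have h1 : condDistrib X T μ =ᵐ[μ.map T] (condDistrib (fun ω => (X ω, Y ω)) T μ).map Prod.fst :=
    condDistrib_comp T (hX.prodMk hY).aemeasurable (f := Prod.fst) measurable_fst
  have h2 : condDistrib X T μ =ᵐ[μ.map T] Kernel.const C (μ.map X) := by
    refine condDistrib_ae_eq_of_measure_eq_compProd T hX.aemeasurable ?_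
    rw [(indepFun_iff_map_prod_eq_prod_map_map hT.aemeasurable hX.aemeasurable).1 hind,
      Measure.compProd_const]
  refine ae_of_ae_map (p := fun t => (condDistrib (fun ω => (X ω, Y ω)) T μ t).fst = μ.map X)
    hT.aemeasurable ?_
  filter_upwards [h1, h2] with t e1 e2
  rw [Kernel.map_apply _ measurable_fst] at e1
  rw [Measure.fst, ← e1]
  exact e2

/-- Markov's inequality for conditional probabilities. -/
theorem measure_condDistrib_ge_le {μ : Measure Ω} [IsProbabilityMeasure μ] {X : Ω → A}
    {T : Ω → C} (hX : Measurable X) (hT : Measurable T) {D : Set (C × A)}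
    (hD : MeasurableSet D) {δ : ℝ} (hδ : 0 < δ) :
    μ {ω | δ ≤ (condDistrib X T μ (T ω)).real (Prod.mk (T ω) ⁻¹' D)} ≤
      (ENNReal.ofReal δ)⁻¹ * μ {ω | (T ω, X ω) ∈ D} := by
  have mk : Measurable fun t => condDistrib X T μ t (Prod.mk t ⁻¹' D) :=
    Kernel.measurable_kernel_prodMk_left hD
  have h1 : ∫⁻ ω, condDistrib X T μ (T ω) (Prod.mk (T ω) ⁻¹' D) ∂μ = μ {ω | (T ω, X ω) ∈ D} := by
    rw [← lintegral_map (f := fun t => condDistrib X T μ t (Prod.mk t ⁻¹' D)) mk hT,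
      ← Measure.compProd_apply hD, compProd_map_condDistrib hX.aemeasurable,
      Measure.map_apply (hT.prodMk hX) hD]
    rfl
  have hδ0 : ENNReal.ofReal δ ≠ 0 := (ENNReal.ofReal_pos.2 hδ).ne'
  rw [← h1, ← ENNReal.div_eq_inv_mul]
  refine le_trans (measure_mono fun ω hω => ?_)
    (meas_ge_le_lintegral_div (mk.comp hT).aemeasurable hδ0 ENNReal.ofReal_ne_top)
  exact ENNReal.ofReal_le_of_le_toReal hω.out

end MutualInformation

/-! ### From outage to a weak composite channel, and from there to a weak channel. -/

section Outage

theorem le_diversityOrder {p : ℝ → ℝ≥0∞} {d : ℝ}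
    (h : ∀ d' < d, ∀ᶠ P in atTop, p P ≤ ENNReal.ofReal (P ^ (-d'))) :
    (d : EReal) ≤ diversityOrder p := by
  refine EReal.ge_of_forall_gt_iff_ge.1 fun d' hd' => ?_
  refine le_liminf_of_le (by isBoundedDefault) ?_
  filter_upwards [h d' (by exact_mod_cast hd'), eventually_gt_atTop 1] with P h1 h2
  have hP : 0 < P := by linarith
  have hlog : 0 < Real.log P := Real.log_pos h2
  have h3 : ENNReal.log (p P) ≤ ((-d' * Real.log P : ℝ) : EReal) := by
    refine (ENNReal.log_monotone h1).trans (le_of_eq ?_)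
    rw [ENNReal.log_ofReal_of_pos (by positivity), Real.log_rpow hP]
  rw [EReal.le_div_iff_mul_le (by exact_mod_cast hlog) (EReal.coe_ne_top _)]
  rw [EReal.le_neg]
  refine h3.trans (le_of_eq ?_)
  norm_cast
  ring

/-- Here $\rho$, $\sigma$, $T$ stand for $\|\mathbf h\|$, $\hat\sigma$ and the power. Below the
threshold, $T\approx P^l$ gives the exponent $l+1-a$ for $\rho^2$. Above it,
$\rho\lesssim\sigma^sP^{(a-1)/2}$. If $\rho$ is at noise level, then $\sigma\lesssim P^{-1/2}$ and
the exponent is $s+1-a$; otherwise $\sigma\le2\rho$, and channel inversion keeps the composite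
channel too strong. -/
theorem norm_le_of_composite_small {a l s c k ε : ℝ} (hs : 1 ≤ s) (hc : 0 < c)
    (hk : 0 < k) (hε : 0 < ε) (hεa : (s + 5) * ε < (1 - a) / 2) :
    ∀ᶠ P : ℝ in atTop, ∀ ρ σ T : ℝ, 0 ≤ ρ → ρ ≤ P ^ ε → σ ≤ ρ + P ^ (ε - 1 / 2) →
      ((σ ≤ 1 / Real.sqrt P ∧ T = c * P ^ l) ∨
        (1 / Real.sqrt P < σ ∧ k * (σ ^ (2 * s))⁻¹ ≤ T)) →
      Real.sqrt T * ρ ≤ P ^ ((a - 1) / 2 + 5 * ε) →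
      ρ ≤ P ^ (-(min l s + 1 - a) / 2 + (s + 6) * ε) := by
  have hsc : 0 < Real.sqrt c := Real.sqrt_pos.2 hc
  have hsk : 0 < Real.sqrt k := Real.sqrt_pos.2 hk
  filter_upwards [eventually_gt_atTop 1, eventually_const_le_rpow (1 / Real.sqrt c) hε,
    eventually_const_le_rpow (2 ^ s / Real.sqrt k) hε] with P hP1 hPc hPk
    ρ σ T hρ0 hρ hσ hT hsmall
  have hP : 0 < P := by linarith
  rw [div_le_iff₀ hsc] at hPc
  rw [div_le_iff₀ hsk] at hPk
  rcases hT with ⟨-, rfl⟩ | ⟨hσ1, hT⟩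
  · have e1 : Real.sqrt (c * P ^ l) = Real.sqrt c * P ^ (l / 2) := by
      rw [Real.sqrt_mul hc.le, Real.sqrt_eq_rpow (P ^ l), ← Real.rpow_mul hP.le]
      congr 2
      ring
    rw [e1] at hsmall
    have hl : 0 < P ^ (l / 2) := by positivity
    have h1 : P ^ (l / 2) * ρ ≤ P ^ ((a - 1) / 2 + 6 * ε) := by
      calc P ^ (l / 2) * ρ = 1 * (P ^ (l / 2) * ρ) := by ring
        _ ≤ (P ^ ε * Real.sqrt c) * (P ^ (l / 2) * ρ) := by gcongr
        _ = P ^ ε * (Real.sqrt c * P ^ (l / 2) * ρ) := by ring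
        _ ≤ P ^ ε * P ^ ((a - 1) / 2 + 5 * ε) := by gcongr
        _ = _ := by rw [← Real.rpow_add hP]; congr 1; ring
    have h2 : ρ ≤ P ^ ((a - 1) / 2 + 6 * ε - l / 2) := by
      rw [Real.rpow_sub hP, le_div_iff₀ hl]
      linarith
    refine h2.trans (Real.rpow_le_rpow_of_exponent_le hP1.le ?_)
    have := min_le_left l s
    nlinarith
  · have hσ0 : 0 < σ := lt_trans (by positivity) hσ1
    have hσs : 0 < σ ^ s := by positivity
    have h1 : Real.sqrt k * (σ ^ s)⁻¹ ≤ Real.sqrt T := by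
      refine Real.le_sqrt_of_sq_le ?_
      refine le_trans (le_of_eq ?_) hT
      rw [mul_pow, Real.sq_sqrt hk.le, inv_pow, mul_comm 2 s, Real.rpow_mul hσ0.le,
        Real.rpow_ofNat]
    have h2 : Real.sqrt k * ρ ≤ σ ^ s * P ^ ((a - 1) / 2 + 5 * ε) := by
      have h3 := (mul_le_mul_of_nonneg_right h1 hρ0).trans hsmall
      calc Real.sqrt k * ρ = σ ^ s * (Real.sqrt k * (σ ^ s)⁻¹ * ρ) := by field_simp
        _ ≤ _ := by gcongr
    rcases le_or_gt ρ (P ^ (ε - 1 / 2)) with hcase | hcase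
    · have h3 : σ ^ s ≤ (P ^ ε * Real.sqrt k) * P ^ (s * ε - s / 2) := by
        calc σ ^ s ≤ (2 * P ^ (ε - 1 / 2)) ^ s := by gcongr; linarith
          _ = 2 ^ s * P ^ (s * ε - s / 2) := by
              rw [Real.mul_rpow (by norm_num) (by positivity), ← Real.rpow_mul hP.le]
              congr 2
              ring
          _ ≤ _ := by gcongr
      have h4 : Real.sqrt k * ρ ≤
          Real.sqrt k * P ^ (ε + (s * ε - s / 2) + ((a - 1) / 2 + 5 * ε)) := by
        calc _ ≤ σ ^ s * P ^ ((a - 1) / 2 + 5 * ε) := h2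
          _ ≤ ((P ^ ε * Real.sqrt k) * P ^ (s * ε - s / 2)) * P ^ ((a - 1) / 2 + 5 * ε) := by
              gcongr
          _ = _ := by
              rw [Real.rpow_add hP (ε + (s * ε - s / 2)), Real.rpow_add hP ε]; ring
      refine (le_of_mul_le_mul_left h4 hsk).trans (Real.rpow_le_rpow_of_exponent_le hP1.le ?_)
      have := min_le_right l s
      nlinarith
    -- This is where $s\ge1$ and $a<1$ enter: $\rho^s\le\rho\,P^{\varepsilon(s-1)}$, so $\rho$
    -- cancels and leaves $1\le P^{(s+5)\varepsilon-(1-a)/2}<1$.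
    · exfalso
      have hρ1 : 0 < ρ := lt_trans (by positivity) hcase
      have h3 : σ ^ s ≤ (P ^ ε * Real.sqrt k) * (ρ * P ^ (ε * (s - 1))) := by
        calc σ ^ s ≤ (2 * ρ) ^ s := by gcongr; linarith
          _ = 2 ^ s * (ρ * ρ ^ (s - 1)) := by
              rw [Real.mul_rpow (by norm_num) hρ0]
              congr 1
              conv_rhs => rw [← Real.rpow_one_add' hρ0 (by linarith)]
              congr 1
              ring
          _ ≤ 2 ^ s * (ρ * (P ^ ε) ^ (s - 1)) := by
              gcongr
          _ = 2 ^ s * (ρ * P ^ (ε * (s - 1))) := by rw [← Real.rpow_mul hP.le]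
          _ ≤ _ := by gcongr
      have h4 : (Real.sqrt k * ρ) * 1 ≤ (Real.sqrt k * ρ) *
          P ^ (ε + ε * (s - 1) + ((a - 1) / 2 + 5 * ε)) := by
        calc _ = Real.sqrt k * ρ := mul_one _
          _ ≤ σ ^ s * P ^ ((a - 1) / 2 + 5 * ε) := h2
          _ ≤ ((P ^ ε * Real.sqrt k) * (ρ * P ^ (ε * (s - 1)))) *
              P ^ ((a - 1) / 2 + 5 * ε) := by gcongr
          _ = _ := by
              rw [Real.rpow_add hP (ε + ε * (s - 1)), Real.rpow_add hP ε]; ring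
      have h5 := le_of_mul_le_mul_left h4 (by positivity)
      have h6 : P ^ (ε + ε * (s - 1) + ((a - 1) / 2 + 5 * ε)) < 1 :=
        Real.rpow_lt_one_of_one_lt_of_neg hP1 (by nlinarith)
      linarith

variable {r : ℕ} {Ω : Type*} [MeasurableSpace Ω] {μ : Measure Ω} {S : Signals r Ω}

/-- Off the two events the denominator is at most $P^{2\varepsilon}$ and the numerator at least
$P^{a+8\varepsilon}$, so the logarithm exceeds $(a+\varepsilon)\log P\ge R_P/\alpha$. -/
theorem outageCAB_le (Q : Params) (hr : 0 < r) (hα : 0 < Q.α)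
    {a ε : ℝ} (hε : 0 < ε) (hR : ∀ᶠ P in atTop, Q.R P / Q.α ≤ (a + ε) * Real.log P) :
    ∀ᶠ P in atTop, outageCAB μ S Q P ≤ μ {ω | P ^ ε ≤ P * condErr μ S Q P ω} +
      μ {ω | ‖pcHat μ S Q P ω‖ < P ^ ((a - 1) / 2 + 4 * ε)} := by
  filter_upwards [eventually_gt_atTop 1, hR, eventually_const_le_rpow 2 hε] with P hP1 hRP h2
  have hP : 0 < P := by linarith
  have hr1 : (1 : ℝ) ≤ r := by exact_mod_cast hr
  refine le_trans (measure_mono_ae ?_) (measure_union_le _ _)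
  filter_upwards [condErr_nonneg μ S Q P] with ω h0 hω
  have hω' : CAB μ S Q P ω < Q.R P := hω
  by_cases c1 : P ^ ε ≤ P * condErr μ S Q P ω
  · exact Or.inl c1
  by_cases c2 : ‖pcHat μ S Q P ω‖ < P ^ ((a - 1) / 2 + 4 * ε)
  · exact Or.inr c2
  exfalso
  push Not at c1 c2
  have hden : P / r * condErr μ S Q P ω + 1 ≤ P ^ (2 * ε) := by
    have h3 : P / r * condErr μ S Q P ω ≤ P * condErr μ S Q P ω := by
      gcongr
      exact div_le_self hP.le hr1
    calc _ ≤ P ^ ε + P ^ ε := by linarith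
      _ = 2 * P ^ ε := by ring
      _ ≤ P ^ ε * P ^ ε := by gcongr
      _ = _ := by rw [← Real.rpow_add hP]; congr 1; ring
  have hden0 : 0 < P / r * condErr μ S Q P ω + 1 := by positivity
  have hnum : P ^ (a + 8 * ε) ≤ P * ‖pcHat μ S Q P ω‖ ^ 2 := by
    calc P ^ (a + 8 * ε) = P ^ (1 : ℝ) * P ^ (((a - 1) / 2 + 4 * ε) * 2) := by
          rw [← Real.rpow_add hP]
          congr 1
          ring
      _ = P * (P ^ ((a - 1) / 2 + 4 * ε)) ^ 2 := by
          rw [Real.rpow_one, Real.rpow_mul hP.le, Real.rpow_ofNat]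
      _ ≤ _ := by gcongr
  have hX : P ^ (a + ε) ≤ P * ‖pcHat μ S Q P ω‖ ^ 2 / (P / r * condErr μ S Q P ω + 1) := by
    rw [le_div_iff₀ hden0]
    calc _ ≤ P ^ (a + ε) * P ^ (2 * ε) := by gcongr
      _ = P ^ (a + 3 * ε) := by rw [← Real.rpow_add hP]; congr 1; ring
      _ ≤ P ^ (a + 8 * ε) := Real.rpow_le_rpow_of_exponent_le hP1.le (by linarith)
      _ ≤ _ := hnum
  have hlog : (a + ε) * Real.log P ≤
      Real.log (1 + P * ‖pcHat μ S Q P ω‖ ^ 2 / (P / r * condErr μ S Q P ω + 1)) := by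
    rw [← Real.log_rpow hP]
    refine Real.log_le_log (by positivity) ?_
    linarith
  have hfin : Q.R P ≤ CAB μ S Q P ω := by
    rw [CAB]
    calc Q.R P = Q.α * (Q.R P / Q.α) := by field_simp
      _ ≤ _ := by gcongr; linarith
  linarith

variable [IsProbabilityMeasure μ]

/-- Outside negligible events, $\mathbf h$ and $w_A$ are at most $P^\varepsilon$ and the estimation
error is below the threshold for $\hat{\mathbf p}_c$. So $\mathbf p_c$ is small together with
$\hat{\mathbf p}_c$, and the deterministic analysis applies. -/
theorem exists_measure_pcHat_le (hS : S.IsRayleigh μ) (Q : Params) (hLB : 1 ≤ Q.LB)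
    (hL₂ : 1 ≤ Q.L₂) (hs : 1 ≤ Q.s) (hc : 0 < Q.c) {k : ℝ} (hk : 0 < k)
    (hkP : ∀ᶠ P in atTop, k ≤ Q.κ P * (Real.exp (Q.R P / Q.α) - 1)) {a ε : ℝ} (ha : 0 ≤ a)
    (hε : 0 < ε) (hεa : (Q.s + 5) * ε < (1 - a) / 2) :
    ∃ q : ℝ → ℝ≥0∞, Negligible q ∧ ∀ᶠ P in atTop,
      μ {ω | ‖pcHat μ S Q P ω‖ < P ^ ((a - 1) / 2 + 4 * ε)} ≤
        q P + ENNReal.ofReal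
          (4 * (P ^ (-(min Q.l Q.s + 1 - a) / 2 + (Q.s + 6) * ε)) ^ 2) ^ r := by
  have n1 := negligible_of_memLp (μ := μ) (f := S.h)
    (fun p hp => Signals.IsRayleigh.memLp_of_law hS.measurable_h hS.law_h hp) hε
  have n2 := negligible_of_memLp (μ := μ) (f := S.wA)
    (fun p hp => Signals.IsRayleigh.memLp_of_law hS.measurable_wA hS.law_wA hp) hε
  have n3 := negligible_pcErr hS Q (by linarith) hL₂ hε
  refine ⟨_, (n1.add n2).add n3, ?_⟩
  filter_upwards [eventually_gt_atTop 1, hkP, eventually_const_le_rpow 2 hε,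
    norm_le_of_composite_small (a := a) (l := Q.l) hs hc hk hε hεa] with P hP1 hkP h2 hpath
  have hP : 0 < P := by linarith
  have hsP : 0 < Real.sqrt P := Real.sqrt_pos.2 hP
  have hdiv : P ^ ε / Real.sqrt P = P ^ (ε - 1 / 2) := by
    rw [Real.rpow_sub hP, Real.sqrt_eq_rpow]
  set t := P ^ (-(min Q.l Q.s + 1 - a) / 2 + (Q.s + 6) * ε)
  have ht : 0 ≤ t := by positivity
  have hsub : {ω | ‖pcHat μ S Q P ω‖ < P ^ ((a - 1) / 2 + 4 * ε)} ⊆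
      (({ω | P ^ ε ≤ ‖S.h ω‖} ∪ {ω | P ^ ε ≤ ‖S.wA ω‖}) ∪
        {ω | P ^ ε ≤ Real.sqrt P * ‖pcErr μ S Q P ω‖}) ∪ S.h ⁻¹' {y | ‖y‖ ≤ t} := by
    intro ω hω
    have hω' : ‖pcHat μ S Q P ω‖ < P ^ ((a - 1) / 2 + 4 * ε) := hω
    by_cases c1 : P ^ ε ≤ ‖S.h ω‖
    · exact Or.inl (Or.inl (Or.inl c1))
    by_cases c2 : P ^ ε ≤ ‖S.wA ω‖
    · exact Or.inl (Or.inl (Or.inr c2))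
    by_cases c3 : P ^ ε ≤ Real.sqrt P * ‖pcErr μ S Q P ω‖
    · exact Or.inl (Or.inr c3)
    refine Or.inr ?_
    push Not at c1 c2 c3
    refine hpath ‖S.h ω‖ (sigmaHat μ S Q P ω) (txPower μ S Q P ω) (norm_nonneg _) c1.le ?_ ?_ ?_
    · refine (sigmaHat_le μ S Q hP hLB ω).trans ?_
      rw [← hdiv]
      gcongr
    · rw [txPower_eq]
      by_cases hσ : sigmaHat μ S Q P ω ≤ 1 / Real.sqrt P
      · left
        simp only [Set.indicator, Set.mem_ofPred_eq, invSigma, if_pos hσ]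
        exact ⟨hσ, by ring⟩
      · right
        refine ⟨not_le.1 hσ, ?_⟩
        have h0 : 0 ≤ (sigmaHat μ S Q P ω ^ (2 * Q.s))⁻¹ := by
          have := invSigma_nonneg μ S Q P ω
          rwa [invSigma, if_neg hσ] at this
        simp only [Set.indicator, Set.mem_ofPred_eq, hσ, invSigma, if_false, zero_add]
        gcongr
    · have e1 : ‖pc μ S Q P ω‖ = Real.sqrt (txPower μ S Q P ω) * ‖S.h ω‖ := by
        rw [pc, norm_smul, Complex.norm_real, Real.norm_of_nonneg (Real.sqrt_nonneg _)]
      have e2 : ‖pc μ S Q P ω‖ ≤ ‖pcHat μ S Q P ω‖ + ‖pcErr μ S Q P ω‖ := by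
        rw [pcErr]
        exact norm_le_norm_add_norm_sub' _ _
      have e3 : ‖pcErr μ S Q P ω‖ ≤ P ^ (ε - 1 / 2) := by
        rw [← hdiv, le_div_iff₀ hsP, mul_comm]
        exact c3.le
      have e4 : P ^ (ε - 1 / 2) ≤ P ^ ((a - 1) / 2 + 4 * ε) :=
        Real.rpow_le_rpow_of_exponent_le hP1.le (by linarith)
      rw [← e1]
      calc ‖pc μ S Q P ω‖ ≤ 2 * P ^ ((a - 1) / 2 + 4 * ε) := by linarith
        _ ≤ P ^ ε * P ^ ((a - 1) / 2 + 4 * ε) := by gcongr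
        _ = _ := by rw [← Real.rpow_add hP]; congr 1; ring
  calc _ ≤ _ := measure_mono hsub
    _ ≤ ((μ {ω | P ^ ε ≤ ‖S.h ω‖} + μ {ω | P ^ ε ≤ ‖S.wA ω‖}) +
        μ {ω | P ^ ε ≤ Real.sqrt P * ‖pcErr μ S Q P ω‖}) + μ (S.h ⁻¹' {y | ‖y‖ ≤ t}) := by
        refine (measure_union_le _ _).trans (add_le_add ?_ le_rfl)
        refine (measure_union_le _ _).trans (add_le_add ?_ le_rfl)
        exact measure_union_le _ _
    _ ≤ _ := by
        refine add_le_add le_rfl ?_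
        rw [← Measure.map_apply hS.measurable_h (measurableSet_le (by fun_prop) (by fun_prop)),
          hS.law_h]
        exact cnVec_norm_le_le r ht

/-- The linear estimate of the data symbol based on the estimate `t` of the composite channel. -/
noncomputable def symbolEstimate (P : ℝ) (t y : CVec r) : ℂ :=
  inner ℂ t y / ((Real.sqrt P * ‖t‖ ^ 2 : ℝ) : ℂ)

theorem norm_sub_symbolEstimate_le {P : ℝ} (hP : 0 < P) {t e w : CVec r} {x : ℂ}
    (ht : 0 < ‖t‖) :
    ‖x - symbolEstimate P t (((Real.sqrt P : ℝ) : ℂ) • (x • (t + e)) + w)‖ ≤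
      (‖x‖ * (Real.sqrt P * ‖e‖) + ‖w‖) / (Real.sqrt P * ‖t‖) := by
  have hsP : 0 < Real.sqrt P := Real.sqrt_pos.2 hP
  have hsP' : ((Real.sqrt P : ℝ) : ℂ) ≠ 0 := by exact_mod_cast hsP.ne'
  have ht' : ((‖t‖ : ℝ) : ℂ) ≠ 0 := by exact_mod_cast ht.ne'
  have h1 : x - symbolEstimate P t (((Real.sqrt P : ℝ) : ℂ) • (x • (t + e)) + w) =
      -(inner ℂ t (((Real.sqrt P : ℝ) : ℂ) • (x • e) + w)) /
        ((Real.sqrt P * ‖t‖ ^ 2 : ℝ) : ℂ) := by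
    rw [symbolEstimate, inner_add_right, inner_smul_right, inner_smul_right, inner_add_right,
      inner_self_eq_norm_sq_to_K, inner_add_right, inner_smul_right, inner_smul_right]
    push_cast
    field_simp
    simp only [Complex.coe_algebraMap]
    ring
  rw [h1, norm_div, norm_neg, Complex.norm_real, Real.norm_of_nonneg (by positivity),
    div_le_div_iff₀ (by positivity) (by positivity)]
  have h2 : ‖((Real.sqrt P : ℝ) : ℂ) • (x • e) + w‖ ≤ ‖x‖ * (Real.sqrt P * ‖e‖) + ‖w‖ := by
    refine (norm_add_le _ _).trans (le_of_eq ?_)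
    rw [norm_smul, norm_smul, Complex.norm_real, Real.norm_of_nonneg hsP.le]
    ring
  calc _ ≤ ‖t‖ * (‖x‖ * (Real.sqrt P * ‖e‖) + ‖w‖) * (Real.sqrt P * ‖t‖) := by
        gcongr
        exact (norm_inner_le_norm _ _).trans (by gcongr)
    _ = _ := by ring

/-- The unconditional probability of a bad symbol estimate is negligible. Markov's inequality makes
the conditional one less than $\varepsilon/4$ for all but negligibly many values of $\hat{\mathbf
p}_c$. For the remaining strong values the estimator bound applies, since $x$ is still
$\mathcal{CN}(0,1)$ given $\hat{\mathbf p}_c$. -/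
theorem outageMI_le (hS : S.IsRayleigh μ) (Q : Params) (hα : 0 < Q.α)
    {a ε : ℝ} (ha1 : a < 1) (ha0 : 0 ≤ a) (hε : 0 < ε) (hε1 : ε ≤ 1)
    (hR : ∀ᶠ P in atTop, Q.R P / Q.α ≤ (a + ε / 4) * Real.log P) :
    ∀ᶠ P in atTop, outageMI μ S Q P ≤
      μ {ω | ‖pcHat μ S Q P ω‖ < P ^ ((a - 1) / 2 + 4 * ε)} +
      (ENNReal.ofReal (ε / 4))⁻¹ * (μ {ω | P ^ ε ≤ ‖S.x ω‖} + μ {ω | P ^ ε ≤ ‖S.w₃ ω‖} +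
        μ {ω | P ^ ε ≤ Real.sqrt P * ‖pcErr μ S Q P ω‖}) := by
  filter_upwards [eventually_gt_atTop 1, hR, eventually_const_le_rpow 4 hε,
    (Real.tendsto_log_atTop.const_mul_atTop (show 0 < ε / 4 by positivity)).eventually_ge_atTop
      (Real.log 2)] with P hP1 hRP h2 h3
  have hP : 0 < P := by linarith
  have hsP : 0 < Real.sqrt P := Real.sqrt_pos.2 hP
  have mT := measurable_pcHat hS Q P
  have mx := hS.measurable_x
  have my := measurable_yd hS Q P
  -- Small enough that $e^{(a+\varepsilon)\log P}\cdot4\tau^2=4P^{-\varepsilon}\le1$, and large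
  -- enough to exceed the estimation error $2P^{-2\varepsilon-a/2}$ off the bad events.
  set τ := P ^ (-ε - a / 2) with hτ
  set D : Set (CVec r × (ℂ × CVec r)) :=
    {p | P ^ ((a - 1) / 2 + 4 * ε) ≤ ‖p.1‖ ∧ τ < ‖p.2.1 - symbolEstimate P p.1 p.2.2‖} with hD
  have mest : Measurable fun p : CVec r × (ℂ × CVec r) => symbolEstimate P p.1 p.2.2 := by
    unfold symbolEstimate
    exact (measurable_fst.inner (measurable_snd.comp measurable_snd)).div (by fun_prop)
  have mD1 : MeasurableSet {p : CVec r × (ℂ × CVec r) | P ^ ((a - 1) / 2 + 4 * ε) ≤ ‖p.1‖} :=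
    measurableSet_le measurable_const (by fun_prop)
  have mD2 : MeasurableSet {p : CVec r × (ℂ × CVec r) |
      τ < ‖p.2.1 - symbolEstimate P p.1 p.2.2‖} := measurableSet_lt measurable_const (by fun_prop)
  have mD : MeasurableSet D := mD1.inter mD2
  have hbad : μ {ω | (pcHat μ S Q P ω, (S.x ω, yd μ S Q P ω)) ∈ D} ≤
      μ {ω | P ^ ε ≤ ‖S.x ω‖} + μ {ω | P ^ ε ≤ ‖S.w₃ ω‖} +
        μ {ω | P ^ ε ≤ Real.sqrt P * ‖pcErr μ S Q P ω‖} := by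
    suffices hsub : {ω | (pcHat μ S Q P ω, (S.x ω, yd μ S Q P ω)) ∈ D} ⊆
        ({ω | P ^ ε ≤ ‖S.x ω‖} ∪ {ω | P ^ ε ≤ ‖S.w₃ ω‖}) ∪
          {ω | P ^ ε ≤ Real.sqrt P * ‖pcErr μ S Q P ω‖} by
      refine (measure_mono hsub).trans ((measure_union_le _ _).trans ?_)
      gcongr
      exact measure_union_le _ _
    intro ω hω
    obtain ⟨hω1, hω2⟩ := hω
    simp only at hω1 hω2
    by_contra hcon
    simp only [Set.mem_union, Set.mem_ofPred_eq, not_or, not_le] at hcon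
    obtain ⟨⟨c1, c2⟩, c3⟩ := hcon
    have ht : 0 < ‖pcHat μ S Q P ω‖ := lt_of_lt_of_le (by positivity) hω1
    have hyd : yd μ S Q P ω = ((Real.sqrt P : ℝ) : ℂ) •
        (S.x ω • (pcHat μ S Q P ω + pcErr μ S Q P ω)) + S.w₃ ω := by
      rw [pcErr, add_sub_cancel, yd, pc, Real.sqrt_mul hP.le, Complex.ofReal_mul, mul_smul,
        smul_comm (S.x ω)]
    rw [hyd] at hω2
    have hb := norm_sub_symbolEstimate_le (x := S.x ω) (e := pcErr μ S Q P ω) (w := S.w₃ ω) hP ht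
    have : τ < τ := by
      calc τ < _ := hω2
        _ ≤ _ := hb
        _ ≤ (P ^ ε * P ^ ε + P ^ ε * P ^ ε) /
            (Real.sqrt P * P ^ ((a - 1) / 2 + 4 * ε)) := by
            have h1P : 1 ≤ P ^ ε := by linarith
            gcongr
            nlinarith
        _ = 2 * P ^ (-2 * ε - a / 2) := by
            rw [Real.sqrt_eq_rpow, ← Real.rpow_add hP, ← Real.rpow_add hP, ← two_mul,
              mul_div_assoc, ← Real.rpow_sub hP]
            congr 2
            ring
        _ ≤ P ^ ε * P ^ (-2 * ε - a / 2) := by gcongr; linarith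
        _ = τ := by rw [← Real.rpow_add hP, hτ]; congr 1; ring
    exact lt_irrefl _ this
  have hmk := measure_condDistrib_ge_le (μ := μ) (X := fun ω => (S.x ω, yd μ S Q P ω))
    (mx.prodMk my) mT mD (δ := ε / 4) (by positivity)
  suffices hae : ∀ᵐ ω ∂μ, ENNReal.ofReal Q.α *
      condMutualInfo μ S.x (yd μ S Q P) (pcHat μ S Q P) (pcHat μ S Q P ω) <
        ENNReal.ofReal (Q.R P) →
      ω ∈ {ω | ‖pcHat μ S Q P ω‖ < P ^ ((a - 1) / 2 + 4 * ε)} ∪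
        {ω | ε / 4 ≤ (condDistrib (fun ω => (S.x ω, yd μ S Q P ω)) (pcHat μ S Q P) μ
          (pcHat μ S Q P ω)).real (Prod.mk (pcHat μ S Q P ω) ⁻¹' D)} by
    unfold outageMI
    refine (measure_mono_ae hae).trans ((measure_union_le _ _).trans ?_)
    refine add_le_add le_rfl (hmk.trans ?_)
    gcongr
  filter_upwards [condDistrib_prod_fst_ae_eq mx my mT (indepFun_x_pcHat hS Q P)] with ω hfst hω'
  by_cases c1 : ‖pcHat μ S Q P ω‖ < P ^ ((a - 1) / 2 + 4 * ε)
  · exact Or.inl c1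
  refine Or.inr ?_
  by_contra c2
  push Not at c1
  have c2' : (condDistrib (fun ω => (S.x ω, yd μ S Q P ω)) (pcHat μ S Q P) μ
      (pcHat μ S Q P ω)).real (Prod.mk (pcHat μ S Q P ω) ⁻¹' D) < ε / 4 := not_le.1 c2
  have hset : Prod.mk (pcHat μ S Q P ω) ⁻¹' D =
      {q | τ < ‖q.1 - symbolEstimate P (pcHat μ S Q P ω) q.2‖} := by
    ext q
    simp [hD, c1]
  rw [hset] at c2'
  have hg : Measurable (symbolEstimate P (pcHat μ S Q P ω)) := by
    unfold symbolEstimate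
    exact (measurable_const.inner measurable_id).div_const _
  have hτ0 : 0 ≤ τ := by positivity
  have ha' : 0 ≤ (a + ε) * Real.log P := mul_nonneg (by linarith) (Real.log_nonneg hP1.le)
  have hexp : Real.exp ((a + ε) * Real.log P) * (4 * τ ^ 2) ≤ 1 := by
    rw [mul_comm (a + ε), ← Real.rpow_def_of_pos hP, hτ, ← Real.rpow_natCast,
      ← Real.rpow_mul hP.le]
    calc _ = 4 * (P ^ (a + ε) * P ^ ((-ε - a / 2) * (2 : ℕ))) := by ring
      _ ≤ P ^ ε * (P ^ (a + ε) * P ^ ((-ε - a / 2) * (2 : ℕ))) := by gcongr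
      _ = P ^ (0 : ℝ) := by
          rw [← Real.rpow_add hP, ← Real.rpow_add hP]
          congr 1
          push_cast
          ring
      _ ≤ 1 := (Real.rpow_zero P).le
  have hMI : ENNReal.ofReal ((1 - ε / 4) * ((a + ε) * Real.log P) - Real.log 2) ≤
      condMutualInfo μ S.x (yd μ S Q P) (pcHat μ S Q P) (pcHat μ S Q P ω) := by
    unfold condMutualInfo
    exact le_mutualInfo_of_estimator _ (hfst.trans hS.law_x) hg hτ0 ha' hexp c2'.le
  have hle : Q.R P / Q.α ≤ (1 - ε / 4) * ((a + ε) * Real.log P) - Real.log 2 := by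
    have hlog : 0 < Real.log P := Real.log_pos hP1
    -- Equivalent to $a+\varepsilon\le2$. One $\varepsilon/4$ covers the slack in the rate, the
    -- other pays for $\log2$.
    have h5 : a + ε / 4 + ε / 4 ≤ (1 - ε / 4) * (a + ε) := by nlinarith
    have h6 := mul_le_mul_of_nonneg_right h5 hlog.le
    linarith
  have : ENNReal.ofReal (Q.R P) ≤ ENNReal.ofReal Q.α *
      condMutualInfo μ S.x (yd μ S Q P) (pcHat μ S Q P) (pcHat μ S Q P ω) := by
    calc ENNReal.ofReal (Q.R P) = ENNReal.ofReal Q.α * ENNReal.ofReal (Q.R P / Q.α) := by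
          rw [← ENNReal.ofReal_mul hα.le]
          congr 1
          field_simp
      _ ≤ _ := by
          gcongr
          exact (ENNReal.ofReal_le_ofReal hle).trans hMI
  exact absurd hω' (not_lt.2 this)

end Outage

/-! ### Choice of $\varepsilon$ and the diversity order. -/

section Diversity

theorem Negligible.add_rpow_le {n : ℝ → ℝ≥0∞} (hn : Negligible n) {K d₁ d₂ : ℝ} (hK : 0 ≤ K)
    (hd : d₁ < d₂) :
    ∀ᶠ P in atTop, n P + ENNReal.ofReal (K * P ^ (-d₂)) ≤ ENNReal.ofReal (P ^ (-d₁)) := by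
  filter_upwards [hn d₂, eventually_gt_atTop 0,
    eventually_const_le_rpow (1 + K) (sub_pos.2 hd)] with P h1 hP h2
  calc _ ≤ ENNReal.ofReal (P ^ (-d₂)) + ENNReal.ofReal (K * P ^ (-d₂)) := by gcongr
    _ = ENNReal.ofReal ((1 + K) * P ^ (-d₂)) := by
        rw [← ENNReal.ofReal_add (by positivity) (by positivity)]
        congr 1
        ring
    _ ≤ ENNReal.ofReal (P ^ (d₂ - d₁) * P ^ (-d₂)) := by gcongr
    _ = _ := by
        rw [← Real.rpow_add hP]
        congr 2
        ring

theorem eventually_rate_le {R : ℝ → ℝ} {g α δ : ℝ} (hα : 0 < α) (hδ : 0 < δ)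
    (hR : Tendsto (fun P => R P / Real.log P) atTop (𝓝 g)) :
    ∀ᶠ P in atTop, R P / α ≤ (g / α + δ) * Real.log P := by
  filter_upwards [hR.eventually_le_const (show g < g + α * δ by linarith [mul_pos hα hδ]),
    eventually_gt_atTop 1] with P h1 h2
  rw [div_le_iff₀ (Real.log_pos h2)] at h1
  rw [div_le_iff₀ hα]
  refine h1.trans (le_of_eq ?_)
  field_simp

variable {r : ℕ} {Ω : Type*} [MeasurableSpace Ω] {μ : Measure Ω} [IsProbabilityMeasure μ]
  {S : Signals r Ω}

/-- Both outage events have the diversity order of the event that the composite channel is weak. -/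
theorem diversityOrder_ge (hS : S.IsRayleigh μ) (Q : Params) (hr : 0 < r) (hLB : 1 ≤ Q.LB)
    (hL₂ : 1 ≤ Q.L₂) (hs : 1 ≤ Q.s) (hc : 0 < Q.c) (hα : 0 < Q.α) {k g : ℝ} (hk : 0 < k)
    (hkP : ∀ᶠ P in atTop, k ≤ Q.κ P * (Real.exp (Q.R P / Q.α) - 1)) (hg0 : 0 ≤ g) (hg : g < Q.α)
    (hR : Tendsto (fun P => Q.R P / Real.log P) atTop (𝓝 g)) :
    ((r * (min Q.l Q.s + 1 - g / Q.α) : ℝ) : EReal) ≤ diversityOrder (fun P => outageCAB μ S Q P) ∧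
    ((r * (min Q.l Q.s + 1 - g / Q.α) : ℝ) : EReal) ≤ diversityOrder (fun P => outageMI μ S Q P) := by
  set a := g / Q.α with ha
  set d := r * (min Q.l Q.s + 1 - a) with hd
  have ha0 : 0 ≤ a := by positivity
  have ha1 : a < 1 := (div_lt_one hα).2 hg
  have hr' : (0 : ℝ) < r := by exact_mod_cast hr
  have core : ∀ d' < d, ∃ ε, 0 < ε ∧ ε ≤ 1 ∧ ∃ q, Negligible q ∧ ∀ᶠ P in atTop,
      μ {ω | ‖pcHat μ S Q P ω‖ < P ^ ((a - 1) / 2 + 4 * ε)} ≤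
        q P + ENNReal.ofReal (4 ^ r * P ^ (-((d + d') / 2))) := by
    intro d' hd'
    -- The second bound is the smallness that the deterministic analysis requires. The third keeps
    -- the loss $2r(s+6)\varepsilon$ in the exponent below $(d-d')/2$, so the decay reaches the
    -- midpoint of $d'$ and $d$ and leaves room for constants.
    set ε := min 1 (min ((1 - a) / (4 * (Q.s + 5))) ((d - d') / (4 * r * (Q.s + 6))))
    have hε : 0 < ε := by
      refine lt_min one_pos (lt_min ?_ ?_)
      · exact div_pos (by linarith) (by linarith)
      · exact div_pos (by linarith) (mul_pos (by positivity) (by linarith))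
    have hε2 : ε * (4 * (Q.s + 5)) ≤ 1 - a := by
      rw [← le_div_iff₀ (by linarith)]
      exact (min_le_right _ _).trans (min_le_left _ _)
    have hε3 : ε * (4 * r * (Q.s + 6)) ≤ d - d' := by
      rw [← le_div_iff₀ (mul_pos (by positivity) (by linarith))]
      exact (min_le_right _ _).trans (min_le_right _ _)
    obtain ⟨q, hq, hqP⟩ := exists_measure_pcHat_le hS Q hLB hL₂ hs hc hk hkP ha0 hε
      (by nlinarith)
    refine ⟨ε, hε, min_le_left _ _, q, hq, ?_⟩
    filter_upwards [hqP, eventually_gt_atTop 1] with P h1 h2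
    have hP : 0 < P := by linarith
    refine h1.trans (add_le_add le_rfl ?_)
    rw [← ENNReal.ofReal_pow (by positivity), mul_pow, ← pow_mul, ← Real.rpow_natCast _ (2 * r),
      ← Real.rpow_mul hP.le]
    gcongr
    · exact h2.le
    · push_cast
      nlinarith
  refine ⟨le_diversityOrder fun d' hd' => ?_, le_diversityOrder fun d' hd' => ?_⟩
  · obtain ⟨ε, hε, -, q, hq, hqP⟩ := core d' hd'
    have n1 := negligible_condErr hS Q (by linarith) hL₂ hε
    filter_upwards [hqP, outageCAB_le (μ := μ) (S := S) Q hr hα hε (eventually_rate_le hα hε hR),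
      (n1.add hq).add_rpow_le (K := 4 ^ r) (d₁ := d') (d₂ := (d + d') / 2) (by positivity)
        (by linarith)] with P h1 h2 h3
    refine h2.trans (le_trans ?_ h3)
    rw [add_assoc]
    exact add_le_add le_rfl h1
  · obtain ⟨ε, hε, hε1, q, hq, hqP⟩ := core d' hd'
    have n1 := negligible_of_memLp (μ := μ) (f := S.x)
      (fun p hp => Signals.IsRayleigh.memLp_of_law hS.measurable_x hS.law_x hp) hε
    have n2 := negligible_of_memLp (μ := μ) (f := S.w₃)
      (fun p hp => Signals.IsRayleigh.memLp_of_law hS.measurable_w₃ hS.law_w₃ hp) hε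
    have n3 := negligible_pcErr hS Q (by linarith) hL₂ hε
    have n4 := ((n1.add n2).add n3).const_mul (C := (ENNReal.ofReal (ε / 4))⁻¹)
      (ENNReal.inv_ne_top.2 (ENNReal.ofReal_pos.2 (by positivity)).ne')
    filter_upwards [hqP, outageMI_le hS Q hα ha1 ha0 hε hε1
        (eventually_rate_le hα (show 0 < ε / 4 by positivity) hR),
      (n4.add hq).add_rpow_le (K := 4 ^ r) (d₁ := d') (d₂ := (d + d') / 2) (by positivity)
        (by linarith)] with P h1 h2 h3
    refine h2.trans (le_trans ?_ h3)
    rw [add_comm]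
    exact (add_le_add le_rfl h1).trans (add_assoc _ _ _).ge

end Diversity

end ThreeWay

theorem theorem2 {Ω : Type*} [MeasurableSpace Ω] (μ : Measure Ω) [IsProbabilityMeasure μ]
    (r : ℕ) (S : ThreeWay.Signals r Ω) (hS : S.IsRayleigh μ)
    (Lc L₁ LB L₂ : ℕ) (hL₁ : 1 ≤ L₁) (hLB : 1 ≤ LB) (hL₂ : 1 ≤ L₂)
    (l s g : ℝ) (hl0 : 0 ≤ l) (hlr : l ≤ r) (hs1 : 1 ≤ s) (hsr : s < r)
    (hg0 : 0 ≤ g) (hg : g < ThreeWay.dataFraction Lc L₁ LB L₂)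
    (R : ℝ → ℝ) (hRpos : ∀ᶠ P in atTop, 0 < R P)
    (hR : Tendsto (fun P => R P / Real.log P) atTop (𝓝 g)) :
    ∃ (c : ℝ) (κ : ℝ → ℝ), 0 < c ∧ (l < r → c = 1) ∧
      let Q : ThreeWay.Params :=
        { Lc := Lc, L₁ := L₁, LB := LB, L₂ := L₂, l := l, s := s, c := c, κ := κ, R := R }
      let d : ℝ := r * (min l s + 1 - g / ThreeWay.dataFraction Lc L₁ LB L₂)
      (∀ᶠ P in atTop, 0 < κ P ∧ ∫ ω, ThreeWay.txPower μ S Q P ω ∂μ = 1) ∧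
      (d : EReal) ≤ ThreeWay.diversityOrder (fun P => ThreeWay.outageCAB μ S Q P) ∧
      (d : EReal) ≤ ThreeWay.diversityOrder (fun P => ThreeWay.outageMI μ S Q P) := by
  have hα : 0 < ThreeWay.dataFraction Lc L₁ LB L₂ := hg0.trans_lt hg
  have hs0 : 0 < s := by linarith
  have hr : 0 < r := by
    have : (0 : ℝ) < r := hs0.trans hsr
    exact_mod_cast this
  obtain ⟨c, κ, k, hc, hc1, hk, hnorm⟩ := ThreeWay.exists_normalization hS Lc L₁ LB L₂ hL₁ hLB
    hlr hs0 hsr hα R hRpos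
  refine ⟨c, κ, hc, hc1, ?_⟩
  intro Q d
  refine ⟨hnorm.mono fun P h => ⟨h.1, h.2.1⟩, ?_⟩
  exact ThreeWay.diversityOrder_ge hS Q hr hLB hL₂ hs1 hc hα hk (hnorm.mono fun P h => h.2.2)
    hg0 hg hR
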